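/- Let $n\ge 1$ be an integer and let $\Delta_{4,n}$ be the set of points of the standard simplex $\{x\in\mathbb{R}^4_{\ge 0}:\ x_1+x_2+x_3+x_4=1\}$ all of whose coordinates are integer multiples of $1/n$. Let $G$ be the graph on $\Delta_{4,n}$ with edge set $E=\{xy:\ \|x-y\|_1=2/n\}$, and let the terminals be the unit vectors $s_i=e^i$, $i=1,\dots,4$. A cut is a map $P:\Delta_{4,n}\to\{1,\dots,5\}$ with $P(s_i)=i$ for $i=1,\dots,4$; it is non-opposite if $P(x)\in\mathrm{Support}(x)\cup\{5\}$ for every $x$. The cost of $P$ for edge weights $w$ is the sum of $w(xy)$ over all edges $xy$ with $P(x)\ne P(y)$. For distinct $i,j$ let $L_{ij}$ be the set of edges both of whose end-nodes have support contained in $\{i,j\}$. Consider the following weights on $E$. * $I_1$ (the scaled Angelidakis–Makarychev–Manurangsi instance; here $3\mid n$): let $\rho=3/(5n)$. Edges not contained in the face $x_4=0$ have weight $0$. In this face, edges joining two nodes of the hexagon $H=\{x:\ x_4=0,\ x_i\le 2/3 \text{ for } i=1,2,3\}$ have weight $\rho$. The remaining edges of the face have an end-node with $x_i>2/3$ for exactly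 one $i\in\{1,2,3\}$. Such an edge, if it lies in some $L_{ij}$ with $j\in\{1,2,3\}\setminus\{i\}$, has weight $(n/3-r)\rho$, where $r$ is the number of edges of $L_{ij}$ between it and $s_i$ (so the edge closest to $s_i$ has weight $(n/3)\rho$, the second closest $(n/3-1)\rho$, and so on); if it lies in no such $L_{ij}$, it has weight $0$ when its end-nodes have the same $i$-th coordinate and weight $\rho$ otherwise. * $I_2$: weight $1/3$ on the edges of $L_{12}\cup L_{13}\cup L_{23}$ and $0$ elsewhere. * $I_3$ (depending on $c\in(0,1/2)$ with $cn$ an integer): for $\{i,j,k\}=\{1,2,3\}$ let $R_k$ be the set of nodes with $x_4=0$ and $x_k=1-c$, together with the nodes with $x_k\ge 1-c$ whose support is contained in $\{i,k\}$ or in $\{j,k\}$. An edge has weight $1/(9c)$ if both its end-nodes lie in $R_k$ for some $k\in\{1,2,3\}$, and $0$ otherwise. * $I_4$: weight $1/n^2$ on every edge of $E$. Then there exist constants $c\in(0,1/2)$ and $\lambda_1,\lambda_2,\lambda_3,\lambda_4\ge 0$ with $\lambda_1+\lambda_2+\lambda_3+\lambda_4=1$ such that every non-opposite cut has cost at least $1.20016-O(1/n)$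 in the instance $I=\lambda_1I_1+\lambda_2I_2+\lambda_3I_3+\lambda_4I_4$. More precisely, one can take $c=0.074125$ and $\lambda_1,\dots,\lambda_4$ that agree with $0.751652,\ 0.147852,\ 0.000275,\ 0.100221$, respectively, up to an error of at most $10^{-6}$ each, and there is an absolute constant $C$ such that for every $n\ge 1$ for which $n/3$ and $cn$ are integers, every non-opposite cut on $\Delta_{4,n}$ has cost at least $1.20016-C/n$ in $I$. -/

import Mathlib

noncomputable section

open scoped Classical

namespace MultiwayCut

/-- The nodes of the discretized simplex `Δ_{4,n}`: the points `x` of the standard simplex in `ℝ⁴`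
all of whose coordinates are integer multiples of `1/n`. The point `x` is stored through the
natural numbers `a i = n * x i`, which sum to `n`. The indices `0, 1, 2, 3 : Fin 4` stand for
`1, 2, 3, 4`. -/
def Node (n : ℕ) : Type := {a : Fin 4 → ℕ // ∑ i, a i = n}

instance (n : ℕ) : Fintype (Node n) :=
  Fintype.subtype (Finset.piAntidiag Finset.univ n) (by simp)

variable {n : ℕ}

/-- The coordinate `x_i` of a node, a multiple of `1/n` in `[0, 1]`. -/
def coord (x : Node n) (i : Fin 4) : ℝ := (x.1 i : ℝ) / (n : ℝ)

/-- The support of a node. -/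
def support (x : Node n) : Set (Fin 4) := {i | coord x i ≠ 0}

/-- The terminal `s_i`, that is, the unit vector `e^i`. -/
def terminal (n : ℕ) (i : Fin 4) : Node n := ⟨Pi.single i n, by simp⟩

/-- The graph `G`: two nodes are adjacent when their `ℓ₁`-distance is `2/n`. -/
def graph (n : ℕ) : SimpleGraph (Node n) where
  Adj x y := x ≠ y ∧ ∑ i, |coord x i - coord y i| = 2 / (n : ℝ)
  symm := ⟨fun x y h => ⟨h.1.symm, by simpa only [abs_sub_comm] using h.2⟩⟩
  loopless := ⟨fun _ h => h.1 rfl⟩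

/-! ### Cuts -/

/-- A cut labels the nodes by `1, …, 5` (here the elements `0, …, 4` of `Fin 5`) so that each
terminal gets its own label. -/
def IsCut (P : Node n → Fin 5) : Prop := ∀ i : Fin 4, P (terminal n i) = i.castSucc

/-- A cut is non-opposite when each node is labeled by an element of its support or by the
extra label. -/
def IsNonOpposite (P : Node n → Fin 5) : Prop :=
  ∀ x, (∃ i ∈ support x, P x = i.castSucc) ∨ P x = Fin.last 4

/-- The cut-set `δ(P)`: the edges whose end-nodes have different labels. -/
def cutSet (P : Node n → Fin 5) : Set (Sym2 (Node n)) :=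
  {e | ∃ x y, e = s(x, y) ∧ (graph n).Adj x y ∧ P x ≠ P y}

/-- The cost of a cut for given edge weights. -/
def cost (w : Sym2 (Node n) → ℝ) (P : Node n → Fin 5) : ℝ :=
  ∑ e : Sym2 (Node n) with e ∈ cutSet P, w e

/-! ### Parts of the graph -/

/-- The edges of the subgraph of `G` induced by a set of nodes. -/
def inducedEdges (S : Set (Node n)) : Set (Sym2 (Node n)) :=
  {e | e ∈ (graph n).edgeSet ∧ ∀ x ∈ e, x ∈ S}

/-- The face spanned by the first three terminals; it is identified with `Δ_{3,n}`. -/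
def face (n : ℕ) : Set (Node n) := {x | coord x 3 = 0}

/-- The boundary nodes `V_{ij}` between `s_i` and `s_j`. -/
def sideNodes (n : ℕ) (i j : Fin 4) : Set (Node n) := {x | support x ⊆ {i, j}}

/-- The boundary edges `L_{ij}` between `s_i` and `s_j`. -/
def sideEdges (n : ℕ) (i j : Fin 4) : Set (Sym2 (Node n)) := inducedEdges (sideNodes n i j)

/-- The boundary edges of the face: the union of `L_{12}`, `L_{13}` and `L_{23}`. -/
def boundaryEdges (n : ℕ) : Set (Sym2 (Node n)) :=
  sideEdges n 0 1 ∪ sideEdges n 0 2 ∪ sideEdges n 1 2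

/-! ### Instance 1 -/

/-- The middle hexagon `H` of the face. -/
def hexagon (n : ℕ) : Set (Node n) := {x | x ∈ face n ∧ ∀ i, i ≠ 3 → coord x i ≤ 2 / 3}

/-- The edges of the face that belong to the corner at `s_i`: those with at least one end-node
in `T_i = {x | x_i > 2/3}`. These are the edges induced by `T_i` together with the edges that
join `T_i` to the line `x_i = 2/3`. -/
def cornerEdges (n : ℕ) (i : Fin 4) : Set (Sym2 (Node n)) :=
  {e | e ∈ inducedEdges (face n) ∧ ∃ x ∈ e, 2 / 3 < coord x i}

/-- An edge is parallel to the side opposite to `s_i` when its end-nodes have the same `i`-th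
coordinate. -/
def IsParallelToOpposite (i : Fin 4) (e : Sym2 (Node n)) : Prop :=
  ∀ x ∈ e, ∀ y ∈ e, coord x i = coord y i

/-- The number of edges of a side of the face at `s_i` that lie between `s_i` and the edge `e` of
that side: `0` for the edge closest to `s_i`, `1` for the second closest, and so on. It is `n`
times `1 - x_i`, where `x` is the end-node of `e` that is closer to `s_i`. -/
def stepsFrom (i : Fin 4) (e : Sym2 (Node n)) : ℝ :=
  (n : ℝ) * (1 - (e.map fun x => coord x i).sup)

/-- `ρ = 3 / (5 n)`. -/
def rho (n : ℕ) : ℝ := 3 / (5 * (n : ℝ))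

/-- The weights of the edges in the corner at `s_i`. On the boundary the edge closest to `s_i` has
weight `(n/3) ρ`, the second closest `(n/3 - 1) ρ`, and so on; of the other edges, those parallel to
the opposite side have weight `0` and the remaining ones weight `ρ`. -/
def cornerWeight (i : Fin 4) (e : Sym2 (Node n)) : ℝ :=
  if e ∈ boundaryEdges n then ((n : ℝ) / 3 - stepsFrom i e) * rho n
  else if IsParallelToOpposite i e then 0
  else rho n

/-- Instance `I₁`: the scaled instance of Angelidakis, Makarychev and Manurangsi on the face,
and weight `0` elsewhere. -/
def instance1 (e : Sym2 (Node n)) : ℝ :=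
  if e ∈ inducedEdges (hexagon n) then rho n
  else if e ∈ cornerEdges n 0 then cornerWeight 0 e
  else if e ∈ cornerEdges n 1 then cornerWeight 1 e
  else if e ∈ cornerEdges n 2 then cornerWeight 2 e
  else 0

/-! ### Instances 2, 3 and 4 -/

/-- Instance `I₂`: weight `1/3` on the boundary edges of the face. -/
def instance2 (e : Sym2 (Node n)) : ℝ := if e ∈ boundaryEdges n then 1 / 3 else 0

/-- The red nodes `R_k` near `s_k`, for `k` one of the first three indices. -/
def redNodes (n : ℕ) (c : ℝ) (k : Fin 4) : Set (Node n) :=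
  {x | coord x 3 = 0 ∧ coord x k = 1 - c} ∪
    {x | (∃ j, j ≠ 3 ∧ j ≠ k ∧ x ∈ sideNodes n j k) ∧ 1 - c ≤ coord x k}

/-- The red edges near the first three terminals: the union of the sets `Γ_k` of the edges that
join two red nodes near `s_k`. -/
def redEdges (n : ℕ) (c : ℝ) : Set (Sym2 (Node n)) :=
  {e | ∃ k, k ≠ 3 ∧ e ∈ inducedEdges (redNodes n c k)}

/-- Instance `I₃`: weight `1/(9c)` on the red edges. -/
def instance3 (c : ℝ) (e : Sym2 (Node n)) : ℝ := if e ∈ redEdges n c then 1 / (9 * c) else 0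

/-- Instance `I₄`: weight `1/n²` on every edge. -/
def instance4 (e : Sym2 (Node n)) : ℝ := if e ∈ (graph n).edgeSet then 1 / (n : ℝ) ^ 2 else 0

/-- The combined instance `I = λ₁ I₁ + λ₂ I₂ + λ₃ I₃ + λ₄ I₄`. -/
def combined (c l₁ l₂ l₃ l₄ : ℝ) (e : Sym2 (Node n)) : ℝ :=
  l₁ * instance1 e + l₂ * instance2 e + l₃ * instance3 c e + l₄ * instance4 e

end MultiwayCut

end

/-! ### Label changes along lattice lines of the triangle, and how they pay for charged side points.
-/

noncomputable section

open scoped Classical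

namespace MultiwayCut

/-! ### Counting label changes along a sequence -/

/-! All four instances are estimated through one labeling of the face `x_4 = 0`: a corner label `i`
is kept only on nodes joined to `s_i` by a path of nodes labeled `i`, and every other face node
becomes unlabeled (`linkedLabel`). This creates no new cut edges. In return, a node labeled `i`
forces the label `i` on every level of `x_i` between that node and the corner (`link_self`). Let `U`
be the number of unlabeled points, and let `T` be `totalChanges`, the weighted number of label
changes along lattice lines, so that `I₁` costs at least `3T/(5n)`.

For `I₁`, each side point lies on two lattice lines, and it charges a line that must change label
because of it. A line pays for its two charges with its label changes, except for the direct lines,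
which run between the two opposite labels with a single change and so fall short by one
(`charge_add_charge_le`). The weighted changes near the corners make the charges of every side total
at least `2n/3`. A direct line makes the opposite side fully charged, about `n`, and direct lines in
different directions cannot overlap too much. Balancing these effects gives `T ≥ 2n - 3 + slack`
(`le_totalChanges`), where the slack counts the label changes used by no charge.

For `I₄`, a Sperner-type injection on small tetrahedra gives cost at least `3/2 - 3U/n²`
(`le_cost_instance4`), so only a face with many unlabeled points makes `I₄` cheap.

There are two cases. If some side of the face has a single label change, then `T - 2n` is at least
`2U/(3n)` up to a constant (`hasExcess_of_one_change`). Since `2λ₁/5` is nearly `3λ₄`, this cancels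
the loss in `I₄`, and `I₂` contributes 1. If all sides have at least two changes, `I₂` contributes
2, which nearly makes up for an `I₄` of cost about 0 when `U` is about `n²/2`. The small remainder
comes from `I₃`: at each of the three corners, either the red cycle is cut at least twice, or it
carries only its corner's label. In the latter case the corner contains no unlabeled points except
those paid for by slack (`card_unlabeled_add_le`), so `U` drops by about `c²n²/2`. -/

/-- The indicator of `a ≠ b`. -/
def differ {α : Type*} (a b : α) : ℕ := if a ≠ b then 1 else 0

lemma differ_self {α : Type*} (a : α) : differ a a = 0 := by simp [differ]

lemma differ_of_ne {α : Type*} {a b : α} (h : a ≠ b) : differ a b = 1 := by simp [differ, h]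

lemma differ_comm {α : Type*} (a b : α) : differ a b = differ b a := by
  simp [differ, eq_comm]

/-- The number of label changes of a sequence between two indices. -/
def changes {α : Type*} (f : ℕ → α) (a b : ℕ) : ℕ :=
  ((Finset.Ico a b).filter fun u => f u ≠ f (u + 1)).card

lemma changes_add {α : Type*} (f : ℕ → α) {a b c : ℕ} (hab : a ≤ b) (hbc : b ≤ c) :
    changes f a b + changes f b c = changes f a c := by
  unfold changes
  rw [← Finset.Ico_union_Ico_eq_Ico hab hbc, Finset.filter_union, Finset.card_union_of_disjoint]
  exact Finset.disjoint_filter_filter (Finset.Ico_disjoint_Ico_consecutive a b c)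

lemma eq_of_changes_eq_zero {α : Type*} {f : ℕ → α} {a b : ℕ} (hab : a ≤ b)
    (h : changes f a b = 0) : f a = f b := by
  induction b, hab using Nat.le_induction with
  | base => rfl
  | succ b hb ih =>
    have h1 := changes_add f hb (show b ≤ b + 1 by omega)
    have h2 : changes f b (b + 1) = 0 := by omega
    rw [ih (by omega)]
    simpa [changes, Finset.filter_singleton] using h2

lemma differ_le_changes {α : Type*} (f : ℕ → α) {a b : ℕ} (hab : a ≤ b) :
    differ (f a) (f b) ≤ changes f a b := by
  unfold differ
  split_ifs with h
  · by_contra h2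
    exact h (eq_of_changes_eq_zero hab (by omega))
  · exact Nat.zero_le _

lemma changes_eq_sum {α : Type*} (f : ℕ → α) (a b : ℕ) :
    changes f a b = ∑ u ∈ Finset.Ico a b, differ (f u) (f (u + 1)) := by
  simp only [changes, Finset.card_filter, differ]

lemma changes_reverse {α : Type*} (f : ℕ → α) (N : ℕ) :
    changes (fun u => f (N - u)) 0 N = changes f 0 N := by
  rw [changes_eq_sum, changes_eq_sum, ← Finset.range_eq_Ico]
  rw [← Finset.sum_range_reflect (fun u => differ (f u) (f (u + 1)))]
  refine Finset.sum_congr rfl fun u hu => ?_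
  have := Finset.mem_range.1 hu
  rw [differ_comm]
  congr 2 <;> omega

lemma changes_congr {α : Type*} {f g : ℕ → α} {a b : ℕ} (h : ∀ u, a ≤ u → u ≤ b → f u = g u) :
    changes f a b = changes g a b := by
  rw [changes_eq_sum, changes_eq_sum]
  refine Finset.sum_congr rfl fun u hu => ?_
  have := Finset.mem_Ico.1 hu
  rw [h u (by omega) (by omega), h (u + 1) (by omega) (by omega)]

/-! ### Barycentric integer coordinates on the triangle -/

/-- The three indices are pairwise distinct. -/
structure Tri (i j k : Fin 3) : Prop where
  ij : i ≠ j
  jk : j ≠ k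
  ik : i ≠ k

namespace Tri
variable {i j k : Fin 3}

lemma rot (h : Tri i j k) : Tri j k i := ⟨h.jk, h.ik.symm, h.ij.symm⟩
lemma swap (h : Tri i j k) : Tri i k j := ⟨h.ik, h.jk.symm, h.ij⟩

lemma eq_or (h : Tri i j k) (l : Fin 3) : l = i ∨ l = j ∨ l = k := by
  obtain ⟨h1, h2, h3⟩ := h
  revert i j k l; decide

lemma sum (h : Tri i j k) (x : Fin 3 → ℕ) : ∑ l, x l = x i + x j + x k := by
  have : (Finset.univ : Finset (Fin 3)) = {i, j, k} := by
    ext l; simpa using h.eq_or l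
  rw [this, Finset.sum_insert (by simp [h.ij, h.ik]), Finset.sum_insert (by simp [h.jk]),
    Finset.sum_singleton, add_assoc]

lemma ext (h : Tri i j k) {x y : Fin 3 → ℕ} (hi : x i = y i) (hj : x j = y j) (hk : x k = y k) :
    x = y := by
  funext l
  rcases h.eq_or l with rfl | rfl | rfl <;> assumption

lemma succ (i : Fin 3) : Tri i (i + 1) (i + 2) := by
  constructor <;> (revert i; decide)

lemma exists_third (hij : i ≠ j) : ∃ k, Tri i j k := by
  have : ∃ k, i ≠ j ∧ j ≠ k ∧ i ≠ k := by revert i j; decide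
  obtain ⟨k, h1, h2, h3⟩ := this
  exact ⟨k, h1, h2, h3⟩

end Tri

/-- The point whose `i`-th coordinate is `t`, whose `j`-th coordinate is `u`, and whose coordinates
sum to `n`. -/
def pt (n : ℕ) (i j : Fin 3) (t u : ℕ) : Fin 3 → ℕ :=
  fun l => if l = i then t else if l = j then u else n - t - u

section pt
variable {n : ℕ} {i j k : Fin 3} {t u : ℕ}

lemma pt_fst : pt n i j t u i = t := by simp [pt]

lemma pt_snd (h : Tri i j k) : pt n i j t u j = u := by simp [pt, h.ij.symm]

lemma pt_thd (h : Tri i j k) : pt n i j t u k = n - t - u := by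
  simp [pt, h.ik.symm, h.jk.symm]

lemma sum_pt (h : Tri i j k) (htu : t + u ≤ n) : ∑ l, pt n i j t u l = n := by
  rw [h.sum, pt_fst, pt_snd h, pt_thd h]; omega

lemma eq_pt (h : Tri i j k) {x : Fin 3 → ℕ} (hx : ∑ l, x l = n) (hi : x i = t) (hj : x j = u) :
    x = pt n i j t u := by
  rw [h.sum] at hx
  refine h.ext ?_ ?_ ?_
  · rw [pt_fst, hi]
  · rw [pt_snd h, hj]
  · rw [pt_thd h]; omega

lemma pt_swap (h : Tri i j k) (htu : t + u ≤ n) : pt n i j t u = pt n i k t (n - t - u) :=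
  eq_pt h.swap (sum_pt h htu) pt_fst (pt_thd h)

lemma pt_comm (h : Tri i j k) (htu : t + u ≤ n) : pt n i j t u = pt n j i u t :=
  eq_pt h.rot.swap (sum_pt h htu) (pt_snd h) pt_fst

end pt

/-! ### Labelings of the triangle -/

/-- A labeling of the points of the triangle of size `n` by the three corners or by `none`, in which
a corner label is used only on points with a positive coordinate there, and in which the points
with a given corner label meet every line between such a point and its corner. -/
structure IsLinkedLabeling (n : ℕ) (lab : (Fin 3 → ℕ) → Option (Fin 3)) : Prop where
  support : ∀ x i, ∑ l, x l = n → lab x = some i → x i ≠ 0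
  corner : ∀ i, lab (Pi.single i n) = some i
  link_self : ∀ x i v, ∑ l, x l = n → lab x = some i → x i ≤ v → v ≤ n →
    ∃ y, ∑ l, y l = n ∧ y i = v ∧ lab y = some i

variable (n : ℕ) (lab : (Fin 3 → ℕ) → Option (Fin 3))

/-- The number of label changes on the line `x i = t`. -/
def lineChanges (i : Fin 3) (t : ℕ) : ℕ :=
  changes (fun u => lab (pt n i (i + 1) t u)) 0 (n - t)

variable {n lab} {i j k : Fin 3}

lemma lineChanges_eq (h : Tri i j k) {t : ℕ} (ht : t ≤ n) :
    lineChanges n lab i t = changes (fun u => lab (pt n i j t u)) 0 (n - t) := by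
  have hs := Tri.succ i
  rcases hs.eq_or j with h1 | rfl | h1
  · exact absurd h1.symm h.ij
  · rfl
  · rw [lineChanges, ← changes_reverse]
    refine changes_congr fun u _ hu => ?_
    rw [pt_swap hs (by omega), h1]
    congr 2; omega

/-- Points in order on a line bound the number of label changes from below. -/
lemma differ_add_le_lineChanges (h : Tri i j k) {t : ℕ} {x y z : Fin 3 → ℕ}
    (hx : ∑ l, x l = n) (hy : ∑ l, y l = n) (hz : ∑ l, z l = n)
    (hxi : x i = t) (hyi : y i = t) (hzi : z i = t) (hxy : x j ≤ y j) (hyz : y j ≤ z j) :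
    differ (lab (pt n i j t 0)) (lab x) + differ (lab x) (lab y) + differ (lab y) (lab z) +
      differ (lab z) (lab (pt n i k t 0)) ≤ lineChanges n lab i t := by
  have hz' := hz
  rw [h.sum] at hz'
  have ht : t ≤ n := by omega
  rw [lineChanges_eq h ht]
  set f : ℕ → Option (Fin 3) := fun u => lab (pt n i j t u) with hf
  have e1 : lab x = f (x j) := by rw [hf]; exact congrArg lab (eq_pt h hx hxi rfl)
  have e2 : lab y = f (y j) := by rw [hf]; exact congrArg lab (eq_pt h hy hyi rfl)
  have e3 : lab z = f (z j) := by rw [hf]; exact congrArg lab (eq_pt h hz hzi rfl)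
  have e4 : lab (pt n i k t 0) = f (n - t) := by
    have := pt_swap h.swap (n := n) (t := t) (u := 0) (by omega)
    simp only [hf, this, Nat.sub_zero]
  have e0 : lab (pt n i j t 0) = f 0 := rfl
  rw [e0, e1, e2, e3, e4]
  have a1 := differ_le_changes f (Nat.zero_le (x j))
  have a2 := differ_le_changes f hxy
  have a3 := differ_le_changes f hyz
  have a4 := differ_le_changes f (show z j ≤ n - t by omega)
  have b1 := changes_add f (Nat.zero_le (x j)) hxy
  have b2 := changes_add f (Nat.zero_le (y j)) hyz
  have b3 := changes_add f (Nat.zero_le (z j)) (show z j ≤ n - t by omega)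
  omega

lemma differ_add_differ_le_lineChanges (h : Tri i j k) {t : ℕ} {x : Fin 3 → ℕ}
    (hx : ∑ l, x l = n) (hxi : x i = t) :
    differ (lab (pt n i j t 0)) (lab x) + differ (lab x) (lab (pt n i k t 0)) ≤
      lineChanges n lab i t := by
  have := differ_add_le_lineChanges (lab := lab) h hx hx hx hxi hxi hxi le_rfl le_rfl
  simpa [differ_self] using this

/-! ### Charges -/

variable (n lab)

/-- The side point on the line `x i = t` with `x k = 0` is charged when its label differs from `i`
and the line carries a label other than `k` and `none`. -/
def charge (i k : Fin 3) (t : ℕ) : ℕ :=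
  if lab (pt n i k t 0) ≠ some i ∧
    ∃ x : Fin 3 → ℕ, ∑ l, x l = n ∧ x i = t ∧ lab x ≠ none ∧ lab x ≠ some k then 1 else 0

/-- The levels `t` up to `2n/3` at which the line `x i = t` runs between the labels of the two other
corners with a single label change. -/
def directLines (i : Fin 3) : Finset ℕ :=
  (Finset.Icc 1 (2 * (n / 3))).filter fun t =>
    lab (pt n i (i + 1) t 0) = some (i + 2) ∧ lab (pt n i (i + 2) t 0) = some (i + 1) ∧
      lineChanges n lab i t = 1

/-- The weighted number of label changes on the part of the side `x k = 0` close to the third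
corner, in terms of the distance `u` from that corner. -/
def cornerChanges (j k : Fin 3) : ℕ :=
  ∑ u ∈ Finset.range (n / 3), (n / 3 - u) * differ (lab (pt n j k u 0)) (lab (pt n j k (u + 1) 0))

variable {n lab}

lemma mem_directLines (h : Tri i j k) {t : ℕ} : t ∈ directLines n lab i ↔
    (1 ≤ t ∧ t ≤ 2 * (n / 3)) ∧ lab (pt n i k t 0) = some j ∧ lab (pt n i j t 0) = some k ∧
      lineChanges n lab i t = 1 := by
  rw [directLines, Finset.mem_filter, Finset.mem_Icc]
  have hs := Tri.succ i
  rcases hs.eq_or j with h1 | h1 | h1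
  · exact absurd h1.symm h.ij
  · rcases hs.eq_or k with h2 | h2 | h2
    · exact absurd h2.symm h.ik
    · exact absurd (h1.trans h2.symm) h.jk
    · rw [h1, h2]; tauto
  · rcases hs.eq_or k with h2 | h2 | h2
    · exact absurd h2.symm h.ik
    · rw [h1, h2]
    · exact absurd (h1.trans h2.symm) h.jk

lemma charge_le_one (i k : Fin 3) (t : ℕ) : charge n lab i k t ≤ 1 := by
  unfold charge; split_ifs <;> simp

lemma charge_eq_one {i k : Fin 3} {t : ℕ} (h : lab (pt n i k t 0) ≠ some i) {x : Fin 3 → ℕ}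
    (hx : ∑ l, x l = n) (hxi : x i = t) (h1 : lab x ≠ none) (h2 : lab x ≠ some k) :
    charge n lab i k t = 1 := by
  rw [charge, if_pos ⟨h, x, hx, hxi, h1, h2⟩]

lemma ne_some_of_apply_eq_zero (L : IsLinkedLabeling n lab) {x : Fin 3 → ℕ}
    (hx : ∑ l, x l = n) (h : x i = 0) : lab x ≠ some i := fun h1 => L.support x i hx h1 h

lemma side_label (L : IsLinkedLabeling n lab) (h : Tri i j k) {t : ℕ} (ht : t ≤ n) :
    lab (pt n i k t 0) ≠ some k :=
  ne_some_of_apply_eq_zero L (sum_pt h.swap (by omega)) (pt_snd h.swap)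

/-- The charges of a line are paid for by its label changes, except on the direct lines. -/
lemma charge_add_charge_le (L : IsLinkedLabeling n lab) (h : Tri i j k) {t : ℕ} (ht1 : 1 ≤ t)
    (ht2 : t ≤ 2 * (n / 3)) : charge n lab i j t + charge n lab i k t ≤
      lineChanges n lab i t + if t ∈ directLines n lab i then 1 else 0 := by
  have ht : t ≤ n := by omega
  have ek := side_label L h ht
  have ej := side_label L h.swap ht
  have hm := mem_directLines (n := n) (lab := lab) h (t := t)
  have key : ∀ x : Fin 3 → ℕ, ∑ l, x l = n → x i = t → _ := fun x hx hxi =>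
    differ_add_differ_le_lineChanges (lab := lab) h hx hxi
  have k0 := key _ (sum_pt h (show t + 0 ≤ n by omega)) pt_fst
  rw [differ_self, zero_add] at k0
  unfold charge
  generalize lab (pt n i k t 0) = a at *
  generalize lab (pt n i j t 0) = b at *
  by_cases hb : b ≠ some i ∧ ∃ x : Fin 3 → ℕ, ∑ l, x l = n ∧ x i = t ∧ lab x ≠ none ∧ lab x ≠ some j
  · rw [if_pos hb]
    obtain ⟨hbi, x, hx, hxi, hx0, hxj⟩ := hb
    have kx := key x hx hxi
    by_cases ha : a ≠ some i ∧
        ∃ x : Fin 3 → ℕ, ∑ l, x l = n ∧ x i = t ∧ lab x ≠ none ∧ lab x ≠ some k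
    · rw [if_pos ha]
      obtain ⟨hai, y, hy, hyi, hy0, hyk⟩ := ha
      have ky := key y hy hyi
      -- Both ends are charged, so neither is labeled `i`. The support condition excludes `j` at one
      -- end and `k` at the other. An unlabeled end `b`, or a witness `y` whose label differs from
      -- that of `a`, gives two changes. What remains is `b = k`, `a = j`: either a direct line or
      -- at least two changes.
      by_cases hb0 : b = none
      · by_cases hxa : lab x = a
        · have ha0 : a = some k := by
            rcases ha' : a with _ | l
            · rw [ha'] at hxa; exact absurd hxa hx0
            · rcases h.eq_or l with rfl | rfl | rfl
              · exact absurd ha' hai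
              · rw [hxa, ha'] at hxj; exact absurd rfl hxj
              · rfl
          exact absurd ha0 ek
        · rw [differ_of_ne (by rw [hb0]; exact Ne.symm hx0), differ_of_ne hxa] at kx
          omega
      · have hbk : b = some k := by
          rcases hb' : b with _ | l
          · exact absurd hb' hb0
          · rcases h.eq_or l with rfl | rfl | rfl
            · exact absurd hb' hbi
            · exact absurd hb' ej
            · rfl
        by_cases hya : lab y = a
        · have haj : a = some j := by
            rcases ha' : a with _ | l
            · rw [ha'] at hya; exact absurd hya hy0
            · rcases h.eq_or l with rfl | rfl | rfl
              · exact absurd ha' hai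
              · rfl
              · exact absurd ha' ek
          have hba : b ≠ a := by
            rw [hbk, haj]; simpa using h.jk.symm
          rw [differ_of_ne hba] at k0
          by_cases hl : lineChanges n lab i t = 1
          · rw [if_pos (hm.2 ⟨⟨ht1, ht2⟩, haj, hbk, hl⟩)]; omega
          · omega
        · rw [differ_of_ne hya, differ_of_ne (by rw [hbk]; exact Ne.symm hyk)] at ky
          omega
    · rw [if_neg ha]
      by_cases hab : b = a
      · by_cases hbx : b = lab x
        · exfalso
          rcases hb' : b with _ | l
          · exact hx0 (hbx ▸ hb')
          · rcases h.eq_or l with rfl | rfl | rfl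
            · exact absurd hb' hbi
            · exact absurd hb' ej
            · exact ek (hab ▸ hb')
        · rw [differ_of_ne hbx] at kx; omega
      · rw [differ_of_ne hab] at k0; omega
  · rw [if_neg hb]
    by_cases ha : a ≠ some i ∧
        ∃ x : Fin 3 → ℕ, ∑ l, x l = n ∧ x i = t ∧ lab x ≠ none ∧ lab x ≠ some k
    · rw [if_pos ha]
      obtain ⟨hai, y, hy, hyi, hy0, hyk⟩ := ha
      have ky := key y hy hyi
      by_cases hab : b = a
      · by_cases hay : lab y = a
        · exfalso
          rcases ha' : a with _ | l
          · exact hy0 (hay.trans ha')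
          · rcases h.eq_or l with rfl | rfl | rfl
            · exact absurd ha' hai
            · exact ej (hab.trans ha')
            · exact absurd ha' ek
        · rw [differ_of_ne hay] at ky; omega
      · rw [differ_of_ne hab] at k0; omega
    · rw [if_neg ha]; omega

end MultiwayCut

end

/-! ### How direct lines constrain each other and the sides, and the bound `2n` for the first
instance. -/

noncomputable section

open scoped Classical

namespace MultiwayCut

variable {n : ℕ} {lab : (Fin 3 → ℕ) → Option (Fin 3)} {i j k : Fin 3}

/-! ### Direct lines -/

lemma directLines_le {t : ℕ} (ht : t ∈ directLines n lab i) : 1 ≤ t ∧ t ≤ 2 * (n / 3) := by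
  rw [directLines, Finset.mem_filter, Finset.mem_Icc] at ht
  exact ht.1

lemma label_of_directLines (h : Tri i j k) {t : ℕ} (ht : t ∈ directLines n lab i)
    {x : Fin 3 → ℕ} (hx : ∑ l, x l = n) (hxi : x i = t) : lab x = some j ∨ lab x = some k := by
  obtain ⟨-, h1, h2, h3⟩ := (mem_directLines h).1 ht
  by_contra! hc
  have := differ_add_differ_le_lineChanges (lab := lab) h hx hxi
  rw [h1, h2, h3, differ_of_ne hc.1, differ_of_ne hc.2.symm] at this
  omega

lemma lt_of_directLines (h : Tri i j k) {t : ℕ} (ht : t ∈ directLines n lab i)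
    {x y : Fin 3 → ℕ} (hx : ∑ l, x l = n) (hxi : x i = t) (hy : ∑ l, y l = n) (hyi : y i = t)
    (hlx : lab x = some k) (hly : lab y = some j) : x j < y j := by
  obtain ⟨-, h1, h2, h3⟩ := (mem_directLines h).1 ht
  by_contra! hc
  have := differ_add_le_lineChanges (lab := lab) h hy hx hx hyi hxi hxi hc le_rfl
  have hjk : (some j : Option (Fin 3)) ≠ some k := by simpa using h.jk
  rw [h1, h2, h3, hlx, hly, differ_of_ne hjk.symm, differ_of_ne hjk] at this
  omega

/-- If the lines met outside the triangle, the end labeled `i` of the line `x j = t` would lie below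
the level `x i = s`. Being linked to its corner, its label would have to appear on that level, but a
direct line there carries only `j` and `k`. -/
lemma directLines_add_le (L : IsLinkedLabeling n lab) (h : Tri i j k) {s t : ℕ}
    (hs : s ∈ directLines n lab i) (ht : t ∈ directLines n lab j) : s + t ≤ n := by
  by_contra! hc
  have b1 := directLines_le hs
  have b2 := directLines_le ht
  obtain ⟨-, h1, -, -⟩ := (mem_directLines (show Tri j i k from ⟨h.ij.symm, h.ik, h.jk⟩)).1 ht
  have h' : Tri j i k := ⟨h.ij.symm, h.ik, h.jk⟩
  have hsum := sum_pt (n := n) h'.swap (t := t) (u := 0) (by omega)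
  obtain ⟨y, hy, hyi, hly⟩ := L.link_self _ i s hsum h1
    (by rw [pt_thd h'.swap]; omega) (by omega)
  rcases label_of_directLines h hs hy hyi with h2 | h2 <;> rw [hly] at h2
  · exact h.ij (Option.some.inj h2)
  · exact h.ik (Option.some.inj h2)

/-- The intersection of two direct lines carries the label of the third corner. -/
lemma label_of_directLines_inter (h : Tri i j k) {x : Fin 3 → ℕ} (hx : ∑ l, x l = n)
    (hi : x i ∈ directLines n lab i) (hj : x j ∈ directLines n lab j) : lab x = some k := by
  rcases label_of_directLines h hi hx rfl with h1 | h1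
  · rcases label_of_directLines h.rot hj hx rfl with h2 | h2
    · exact h2
    · rw [h1] at h2; exact absurd (Option.some.inj h2) h.ij.symm
  · exact h1

/-- The line `x k = t` meets the other two direct lines in points labeled `j` and `i`. If the sum of
levels exceeded `n`, these points would occur in the wrong order for a line with a single change. -/
lemma directLines_add_add_le (L : IsLinkedLabeling n lab) (h : Tri i j k) {r s t : ℕ}
    (hr : r ∈ directLines n lab i) (hs : s ∈ directLines n lab j) (ht : t ∈ directLines n lab k) :
    r + s + t ≤ n := by
  by_contra! hc
  have a1 := directLines_add_le L h hr hs
  have a2 := directLines_add_le L h.rot hs ht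
  have a3 := directLines_add_le L h.rot.rot ht hr
  have x1 := sum_pt (n := n) h.rot.rot (t := t) (u := r) (by omega)
  have x2 := sum_pt (n := n) h.rot.rot.swap (t := t) (u := s) (by omega)
  have l1 : lab (pt n k i t r) = some j := label_of_directLines_inter h.rot.rot x1
    (by rw [pt_fst]; exact ht) (by rw [pt_snd h.rot.rot]; exact hr)
  have l2 : lab (pt n k j t s) = some i := label_of_directLines_inter h.rot.rot.swap x2
    (by rw [pt_fst]; exact ht) (by rw [pt_snd h.rot.rot.swap]; exact hs)
  have := lt_of_directLines h.rot.rot.swap ht x2 pt_fst x1 pt_fst l2 l1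
  rw [pt_snd h.rot.rot.swap, pt_thd h.rot.rot] at this
  omega

/-! ### Charges of a side -/

/-- The levels `t` and `n - t` name the two lines through one point of the side `x k = 0`. If that
point is labeled `i` or `j`, it witnesses its own charge on the line of the other index. If it is
unlabeled, the line containing `x` is charged. -/
lemma one_le_charge_add_charge (L : IsLinkedLabeling n lab) (h : Tri i j k) {t : ℕ} (htn : t ≤ n)
    {x : Fin 3 → ℕ} (hx : ∑ l, x l = n) (hxt : x j = t ∨ x i = n - t) (h0 : lab x ≠ none)
    (hk : lab x ≠ some k) : 1 ≤ charge n lab j k t + charge n lab i k (n - t) := by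
  have h' : Tri j i k := ⟨h.ij.symm, h.ik, h.jk⟩
  have e : pt n j k t 0 = pt n i k (n - t) 0 :=
    eq_pt h.swap (sum_pt h'.swap (by omega)) (by rw [pt_thd h'.swap]; omega) (pt_snd h'.swap)
  have hv := side_label L h' htn
  have hs := sum_pt (n := n) h'.swap (t := t) (u := 0) (by omega)
  rcases hl : lab (pt n j k t 0) with _ | l
  · rcases hxt with hxt | hxt
    · rw [charge_eq_one (by rw [hl]; simp) hx hxt h0 hk]; omega
    · rw [charge_eq_one (i := i) (by rw [← e, hl]; simp) hx hxt h0 hk]; omega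
  · rcases h.eq_or l with rfl | rfl | rfl
    · rw [charge_eq_one (by rw [hl]; simpa using h.ij) hs pt_fst (by rw [hl]; simp) hv]; omega
    · rw [charge_eq_one (i := i) (by rw [← e, hl]; simpa using h.ij.symm) hs
        (by rw [e, pt_fst]) (by rw [hl]; simp) hv]; omega
    · exact absurd hl hv

/-- A direct line parallel to the side carries only the labels `i` and `j`. It usually crosses one
of the two lines through the side point, and any crossing point is a witness. If it crosses neither,
its end labeled `i` is linked to the corner, so the label `i` appears on the line `x i = n - t`. -/
lemma one_le_charge_of_directLines (L : IsLinkedLabeling n lab) (h : Tri i j k) {s t : ℕ}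
    (hs : s ∈ directLines n lab k) (htn : t ≤ n) :
    1 ≤ charge n lab j k t + charge n lab i k (n - t) := by
  have b := directLines_le hs
  have nn : ∀ x : Fin 3 → ℕ, ∑ l, x l = n → x k = s → lab x ≠ none ∧ lab x ≠ some k := by
    intro x hx hxk
    rcases label_of_directLines h.rot.rot hs hx hxk with h1 | h1 <;> rw [h1]
    · exact ⟨by simp, by simpa using h.ik⟩
    · exact ⟨by simp, by simpa using h.jk⟩
  have h2 : Tri j k i := h.rot
  have h3 : Tri i k j := h.swap
  by_cases h4 : s ≤ n - t
  · have hx := sum_pt (n := n) h2 (t := t) (u := s) (by omega)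
    obtain ⟨n1, n2⟩ := nn _ hx (pt_snd h2)
    exact one_le_charge_add_charge L h htn hx (Or.inl pt_fst) n1 n2
  · by_cases h5 : s ≤ t
    · have hx := sum_pt (n := n) h3 (t := n - t) (u := s) (by omega)
      obtain ⟨n1, n2⟩ := nn _ hx (pt_snd h3)
      exact one_le_charge_add_charge L h htn hx (Or.inr pt_fst) n1 n2
    · obtain ⟨-, -, h1, -⟩ := (mem_directLines (show Tri k j i from h.rot.rot.swap)).1 hs
      obtain ⟨-, h1, -, -⟩ := (mem_directLines h.rot.rot).1 hs
      obtain ⟨y, hy, hyi, hly⟩ := L.link_self _ i (n - t)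
        (sum_pt (n := n) h.rot.rot.swap (t := s) (u := 0) (by omega)) h1
        (by rw [pt_thd h.rot.rot.swap]; omega) (by omega)
      exact one_le_charge_add_charge L h htn hy (Or.inr hyi) (by rw [hly]; simp)
        (by rw [hly]; simpa using h.ik)

variable (n lab)

/-- The charges of the part of the side `x k = 0` on the lines `x j = t`, and the weighted label
changes near the third corner. -/
def sideCharge (j k : Fin 3) : ℕ :=
  ∑ t ∈ Finset.Icc 1 (2 * (n / 3)), charge n lab j k t + cornerChanges n lab j k

variable {n lab}

lemma pt_zero_zero (h : Tri i j k) : pt n j k 0 0 = Pi.single i n := by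
  refine h.ext ?_ ?_ ?_
  · rw [pt_thd h.rot]; simp
  · rw [pt_fst, Pi.single_eq_of_ne h.ij.symm]
  · rw [pt_snd h.rot, Pi.single_eq_of_ne h.ik.symm]

/-- Near each corner of a side, the charges and the weighted label changes add up to `n / 3`. -/
lemma le_sum_charge_add_cornerChanges (L : IsLinkedLabeling n lab) (h : Tri i j k) :
    n / 3 ≤ ∑ t ∈ Finset.Icc 1 (n / 3), charge n lab j k t + cornerChanges n lab j k := by
  have hch : ∀ t ≤ n, lab (pt n j k t 0) = some i → charge n lab j k t = 1 := fun t ht hl =>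
    charge_eq_one (by rw [hl]; simpa using h.ij) (sum_pt h.rot (u := 0) (by omega)) pt_fst
      (by rw [hl]; simp) (by rw [hl]; simpa using h.ik)
  have h0 : lab (pt n j k 0 0) = some i := by rw [pt_zero_zero h, L.corner]
  by_cases hall : ∀ t ≤ n / 3, lab (pt n j k t 0) = some i
  · have : ∑ t ∈ Finset.Icc 1 (n / 3), charge n lab j k t = n / 3 := by
      rw [Finset.sum_congr rfl (g := fun _ => 1) fun t ht => hch t
        (by have := Finset.mem_Icc.1 ht; omega) (hall t (Finset.mem_Icc.1 ht).2)]
      simp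
    omega
  · push Not at hall
    -- At the first level `p` whose label is not `i`, the `p - 1` earlier positive levels are all
    -- charged. The change from `p - 1` to `p` has weight `n / 3 - (p - 1)`, exactly the missing
    -- amount.
    have hp := Nat.find_spec hall
    have hmin := fun m (hm : m < Nat.find hall) => Nat.find_min hall hm
    set p := Nat.find hall
    have hp0 : p ≠ 0 := fun h1 => hp.2 (by rw [h1, h0])
    have hbefore : ∀ m < p, lab (pt n j k m 0) = some i := fun m hm => by
      have := hmin m hm
      push Not at this
      exact this (by omega)
    have e1 : p - 1 ≤ ∑ t ∈ Finset.Icc 1 (n / 3), charge n lab j k t := by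
      calc p - 1 = ∑ t ∈ Finset.Icc 1 (p - 1), 1 := by simp
        _ = ∑ t ∈ Finset.Icc 1 (p - 1), charge n lab j k t :=
            Finset.sum_congr rfl fun t ht => by
              have := Finset.mem_Icc.1 ht
              rw [hch t (by omega) (hbefore t (by omega))]
        _ ≤ _ := Finset.sum_le_sum_of_subset (Finset.Icc_subset_Icc le_rfl (by omega))
    have e2 : n / 3 - (p - 1) ≤ cornerChanges n lab j k := by
      refine le_trans ?_ (Finset.single_le_sum (fun _ _ => Nat.zero_le _)
        (Finset.mem_range.2 (show p - 1 < n / 3 by omega)))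
      rw [Nat.sub_add_cancel (by omega), hbefore (p - 1) (by omega),
        differ_of_ne hp.2.symm]
      omega
    omega

lemma le_sideCharge (L : IsLinkedLabeling n lab) (h : Tri i j k) :
    n / 3 ≤ sideCharge n lab j k := by
  refine (le_sum_charge_add_cornerChanges L h).trans ?_
  exact Nat.add_le_add_right
    (Finset.sum_le_sum_of_subset (Finset.Icc_subset_Icc le_rfl (by omega))) _

/-- Both ends of a direct line are charged, so each side reached by direct lines is charged enough
to absorb the deficit they cause in `totalChanges_add`. -/
lemma card_directLines_le_sideCharge (h : Tri i j k) :
    (directLines n lab j).card ≤ sideCharge n lab j k := by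
  refine le_trans ?_ (Nat.le_add_right _ _)
  calc (directLines n lab j).card = ∑ t ∈ directLines n lab j, 1 := by simp
    _ = ∑ t ∈ directLines n lab j, charge n lab j k t := Finset.sum_congr rfl fun t ht => by
        obtain ⟨-, h1, -, -⟩ := (mem_directLines h.rot.swap).1 ht
        have := directLines_le ht
        exact (charge_eq_one (by rw [h1]; simpa using h.ij) (sum_pt h.rot (u := 0) (by omega)) pt_fst
          (by rw [h1]; simp) (by rw [h1]; simpa using h.ik)).symm
    _ ≤ _ := Finset.sum_le_sum_of_subset (Finset.filter_subset _ _)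

lemma sum_reflect_Ioo (hn : 3 ∣ n) (f : ℕ → ℕ) :
    ∑ t ∈ Finset.Ioo (n / 3) (2 * (n / 3)), f (n - t) =
      ∑ t ∈ Finset.Ioo (n / 3) (2 * (n / 3)), f t := by
  refine Finset.sum_nbij' (fun t => n - t) (fun t => n - t) ?_ ?_ ?_ ?_ ?_ <;>
    · intro t ht
      simp only [Finset.mem_Ioo] at *
      try omega

/-- The charges of a side, split into the two ends and the middle third. -/
lemma le_sideCharge_add_sideCharge (hn : 3 ∣ n) (L : IsLinkedLabeling n lab) (h : Tri i j k) :
    2 * (n / 3) + ∑ t ∈ Finset.Ioo (n / 3) (2 * (n / 3)),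
      (charge n lab j k t + charge n lab i k (n - t)) ≤
      sideCharge n lab j k + sideCharge n lab i k := by
  have h' : Tri j i k := ⟨h.ij.symm, h.ik, h.jk⟩
  have key : ∀ f : ℕ → ℕ, ∑ t ∈ Finset.Icc 1 (n / 3), f t +
      ∑ t ∈ Finset.Ioo (n / 3) (2 * (n / 3)), f t ≤ ∑ t ∈ Finset.Icc 1 (2 * (n / 3)), f t := by
    intro f
    rw [← Finset.sum_union]
    · refine Finset.sum_le_sum_of_subset fun t ht => ?_
      simp only [Finset.mem_union, Finset.mem_Icc, Finset.mem_Ioo] at *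
      omega
    · rw [Finset.disjoint_left]
      intro t ht
      simp only [Finset.mem_Icc, Finset.mem_Ioo] at *
      omega
  have a1 := le_sum_charge_add_cornerChanges L h
  have a2 := le_sum_charge_add_cornerChanges L h'
  have b1 := key (charge n lab j k)
  have b2 := key (charge n lab i k)
  rw [Finset.sum_add_distrib, sum_reflect_Ioo hn (charge n lab i k)]
  unfold sideCharge
  omega

/-- The two ends contribute `n / 3` each. The open middle third has `n / 3 - 1` levels, hence the
extra 1. -/
lemma le_sideCharge_add_of_forall (hn : 3 ∣ n) (L : IsLinkedLabeling n lab) (h : Tri i j k)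
    (hc : ∀ t ≤ n, 1 ≤ charge n lab j k t + charge n lab i k (n - t)) :
    3 * (n / 3) ≤ sideCharge n lab j k + sideCharge n lab i k + 1 := by
  have h1 := le_sideCharge_add_sideCharge hn L h
  have h2 : ∑ t ∈ Finset.Ioo (n / 3) (2 * (n / 3)), 1 ≤ ∑ t ∈ Finset.Ioo (n / 3) (2 * (n / 3)),
      (charge n lab j k t + charge n lab i k (n - t)) :=
    Finset.sum_le_sum fun t ht => hc t (by have := Finset.mem_Ioo.1 ht; omega)
  simp only [Finset.sum_const, Nat.card_Ioo, smul_eq_mul] at h2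
  omega

/-! ### The total of all weighted label changes -/

variable (n lab)

/-- The label changes of a line that are not used by the charges. -/
def slack (i : Fin 3) (t : ℕ) : ℕ :=
  lineChanges n lab i t + (if t ∈ directLines n lab i then 1 else 0) -
    (charge n lab i (i + 1) t + charge n lab i (i + 2) t)

/-- The unused label changes of all lines in one direction. -/
def slackSum (i : Fin 3) : ℕ := ∑ t ∈ Finset.Icc 1 (2 * (n / 3)), slack n lab i t

/-- The weighted number of label changes in the first instance, in units of `rho`. -/
def totalChanges : ℕ :=
  ∑ i, (∑ t ∈ Finset.Icc 1 (2 * (n / 3)), lineChanges n lab i t +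
    (cornerChanges n lab i (i + 1) + cornerChanges n lab i (i + 2)))

variable {n lab}

lemma Tri.add_eq (h : Tri i j k) (f : Fin 3 → ℕ) : f (i + 1) + f (i + 2) = f j + f k := by
  have h1 := (Tri.succ i).sum f
  rw [h.sum] at h1
  omega

lemma slack_eq (h : Tri i j k) (t : ℕ) : slack n lab i t =
    lineChanges n lab i t + (if t ∈ directLines n lab i then 1 else 0) -
      (charge n lab i j t + charge n lab i k t) := by
  rw [slack, h.add_eq fun l => charge n lab i l t]

/-- The bookkeeping identity of the charging scheme: charges are collected by line and regrouped by
side. The natural subtraction in `slack` is never truncated, thanks to `charge_add_charge_le`, so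
equality holds. -/
lemma totalChanges_add (L : IsLinkedLabeling n lab) (h : Tri i j k) :
    totalChanges n lab + ((directLines n lab i).card + (directLines n lab j).card +
      (directLines n lab k).card) =
    (sideCharge n lab j k + sideCharge n lab i k) + (sideCharge n lab k i + sideCharge n lab j i) +
      (sideCharge n lab i j + sideCharge n lab k j) +
      (slackSum n lab i + slackSum n lab j + slackSum n lab k) := by
  have key : ∀ {i j k : Fin 3}, Tri i j k →
      (∑ t ∈ Finset.Icc 1 (2 * (n / 3)), lineChanges n lab i t +
        (cornerChanges n lab i (i + 1) + cornerChanges n lab i (i + 2))) +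
        (directLines n lab i).card =
      sideCharge n lab i j + sideCharge n lab i k + slackSum n lab i := by
    intro i j k h
    have e1 : (directLines n lab i).card =
        ∑ t ∈ Finset.Icc 1 (2 * (n / 3)), if t ∈ directLines n lab i then 1 else 0 := by
      rw [← Finset.card_filter]
      congr 1
      ext t
      rw [Finset.mem_filter, Finset.mem_Icc]
      exact ⟨fun ht => ⟨directLines_le ht, ht⟩, fun ht => ht.2⟩
    have e2 : ∑ t ∈ Finset.Icc 1 (2 * (n / 3)), (lineChanges n lab i t +
        if t ∈ directLines n lab i then 1 else 0) = ∑ t ∈ Finset.Icc 1 (2 * (n / 3)),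
          (charge n lab i j t + charge n lab i k t + slack n lab i t) := by
      refine Finset.sum_congr rfl fun t ht => ?_
      have ht := Finset.mem_Icc.1 ht
      have := charge_add_charge_le L h ht.1 ht.2
      rw [slack_eq h]
      omega
    rw [Finset.sum_add_distrib, Finset.sum_add_distrib, Finset.sum_add_distrib] at e2
    rw [h.add_eq fun l => cornerChanges n lab i l, e1, slackSum, sideCharge, sideCharge]
    omega
  rw [totalChanges, h.sum fun i => (∑ t ∈ Finset.Icc 1 (2 * (n / 3)), lineChanges n lab i t +
    (cornerChanges n lab i (i + 1) + cornerChanges n lab i (i + 2)))]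
  have k1 := key h
  have k2 := key h.rot
  have k3 := key h.rot.rot
  omega

lemma le_sideCharge_of_nonempty (hn : 3 ∣ n) (L : IsLinkedLabeling n lab) (h : Tri i j k)
    (hk : (directLines n lab k).card ≠ 0) :
    3 * (n / 3) ≤ sideCharge n lab j k + sideCharge n lab i k + 1 := by
  obtain ⟨s, hs⟩ := Finset.card_ne_zero.1 hk
  exact le_sideCharge_add_of_forall hn L h fun t ht => one_le_charge_of_directLines L h hs ht

/-- The largest level of a direct line, or `0` if there is none. -/
lemma exists_top_directLine (i : Fin 3) : ∃ t : ℕ, (directLines n lab i).card ≤ t ∧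
    (∀ s ∈ directLines n lab i, s ≤ t) ∧
    ((directLines n lab i).card ≠ 0 → t ∈ directLines n lab i) ∧
    ((directLines n lab i).card = 0 → t = 0) := by
  refine ⟨(directLines n lab i).sup id, ?_, fun s hs => Finset.le_sup (f := id) hs, fun h => ?_,
    fun h => ?_⟩
  · have : directLines n lab i ⊆ Finset.Icc 1 ((directLines n lab i).sup id) := fun s hs =>
      Finset.mem_Icc.2 ⟨(directLines_le hs).1, Finset.le_sup (f := id) hs⟩
    simpa using Finset.card_le_card this
  · obtain ⟨s, hs, e⟩ := Finset.exists_mem_eq_sup _ (Finset.card_ne_zero.1 h) id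
    rw [e]; exact hs
  · rw [Finset.card_eq_zero.1 h]; rfl

/-- Two thirds of the instance: `2 n` weighted label changes, and the unused ones. -/
theorem le_totalChanges (hn : 3 ∣ n) (L : IsLinkedLabeling n lab) (h : Tri i j k) :
    2 * n + (slackSum n lab i + slackSum n lab j + slackSum n lab k) ≤ totalChanges n lab + 3 := by
  have e := totalChanges_add L h
  obtain ⟨ti, i1, -, i2, i3⟩ := exists_top_directLine (n := n) (lab := lab) i
  obtain ⟨tj, j1, -, j2, j3⟩ := exists_top_directLine (n := n) (lab := lab) j
  obtain ⟨tk, k1, -, k2, k3⟩ := exists_top_directLine (n := n) (lab := lab) k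
  have a1 := le_sideCharge L h
  have a2 := le_sideCharge L h.rot
  have a3 := le_sideCharge L h.rot.rot
  have a4 := le_sideCharge L h.swap
  have a5 := le_sideCharge L h.rot.swap
  have a6 := le_sideCharge L h.rot.rot.swap
  have b1 := card_directLines_le_sideCharge (n := n) (lab := lab) h
  have b2 := card_directLines_le_sideCharge (n := n) (lab := lab) h.rot
  have b3 := card_directLines_le_sideCharge (n := n) (lab := lab) h.rot.rot
  have b4 := card_directLines_le_sideCharge (n := n) (lab := lab) h.swap
  have b5 := card_directLines_le_sideCharge (n := n) (lab := lab) h.rot.swap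
  have b6 := card_directLines_le_sideCharge (n := n) (lab := lab) h.rot.rot.swap
  have c1 := le_sideCharge_of_nonempty hn L h
  have c2 := le_sideCharge_of_nonempty hn L h.rot
  have c3 := le_sideCharge_of_nonempty hn L h.rot.rot
  -- Cases by the number of directions with direct lines. None: each side has at least `2n/3`. One,
  -- with `d` lines: the opposite side gives `n - 1`, the other two `2n/3 + 2 max(d, n/3)`, and `d`
  -- is subtracted. Two: the two full sides give `2n - 2`, and the third side pays for both sets of
  -- direct lines. Three: the sides give `3n - 3`, and the direct lines number at most `n` by `d`.
  have d : (directLines n lab i).card ≠ 0 → (directLines n lab j).card ≠ 0 →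
      (directLines n lab k).card ≠ 0 → ti + tj + tk ≤ n :=
    fun x y z => directLines_add_add_le L h (i2 x) (j2 y) (k2 z)
  omega

end MultiwayCut

end

/-! ### Counting unlabeled points against the excess of `totalChanges` over `2n`. -/

noncomputable section

open scoped Classical

namespace MultiwayCut

variable {n : ℕ} {lab : (Fin 3 → ℕ) → Option (Fin 3)} {i j k : Fin 3}

/-! ### Counting points -/

/-- The points of the triangle of size `n`. -/
def points (n : ℕ) : Finset (Fin 3 → ℕ) := Finset.piAntidiag Finset.univ n

lemma mem_points {x : Fin 3 → ℕ} : x ∈ points n ↔ ∑ l, x l = n := by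
  simp [points]

variable (n lab)

/-- The points without a corner label. -/
def unlabeled : Finset (Fin 3 → ℕ) := (points n).filter fun x => lab x = none

variable {n lab}

lemma mem_unlabeled {x : Fin 3 → ℕ} : x ∈ unlabeled n lab ↔ ∑ l, x l = n ∧ lab x = none := by
  rw [unlabeled, Finset.mem_filter, mem_points]

lemma card_le_mul (h : Tri i j k) {S : Finset (Fin 3 → ℕ)} {A B : Finset ℕ}
    (hS : ∀ x ∈ S, ∑ l, x l = n) (hA : ∀ x ∈ S, x i ∈ A) (hB : ∀ x ∈ S, x j ∈ B) :
    S.card ≤ A.card * B.card := by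
  rw [← Finset.card_product]
  refine Finset.card_le_card_of_injOn (fun x => (x i, x j)) (fun x hx => ?_) ?_
  · exact Finset.mem_product.2 ⟨hA x hx, hB x hx⟩
  · intro x hx y hy e
    rw [Finset.mem_coe] at hx hy
    have e1 : x i = y i := congrArg Prod.fst e
    have e2 : x j = y j := congrArg Prod.snd e
    rw [eq_pt h (hS x hx) e1 e2, ← eq_pt h (hS y hy) rfl rfl]

lemma card_le_mul_succ (h : Tri i j k) {S : Finset (Fin 3 → ℕ)} {A : Finset ℕ}
    (hS : ∀ x ∈ S, ∑ l, x l = n) (hA : ∀ x ∈ S, x i ∈ A) :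
    S.card ≤ A.card * (n + 1) := by
  have := card_le_mul h (B := Finset.range (n + 1)) hS hA fun x hx => by
    have := hS x hx
    rw [h.sum] at this
    rw [Finset.mem_range]; omega
  simpa using this

/-- The number of points on a line. -/
lemma card_points_line (h : Tri i j k) {t : ℕ} (ht : t ≤ n) :
    ((points n).filter fun x => x i = t).card = n - t + 1 := by
  have : (points n).filter (fun x => x i = t) =
      (Finset.range (n - t + 1)).image fun u => pt n i j t u := by
    ext x
    rw [Finset.mem_filter, mem_points, Finset.mem_image]
    constructor
    · rintro ⟨hx, hxi⟩
      have hx' := hx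
      rw [h.sum] at hx'
      exact ⟨x j, Finset.mem_range.2 (by omega), (eq_pt h hx hxi rfl).symm⟩
    · rintro ⟨u, hu, rfl⟩
      have := Finset.mem_range.1 hu
      exact ⟨sum_pt h (by omega), pt_fst⟩
  rw [this, Finset.card_image_of_injOn, Finset.card_range]
  intro u hu v hv e
  have := congrFun e j
  simpa [pt_snd h] using this

lemma card_points_of_mem (h : Tri i j k) {A : Finset ℕ} (hA : ∀ t ∈ A, t ≤ n) :
    ((points n).filter fun x => x i ∈ A).card = ∑ t ∈ A, (n - t + 1) := by
  rw [Finset.card_eq_sum_card_fiberwise (f := fun x => x i) (t := A)]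
  · refine Finset.sum_congr rfl fun t ht => ?_
    rw [← card_points_line h (hA t ht), Finset.filter_filter]
    congr 1
    ext x
    simp only [Finset.mem_filter]
    constructor
    · rintro ⟨h1, h2, h3⟩; exact ⟨h1, h3⟩
    · rintro ⟨h1, h3⟩; exact ⟨h1, by rw [h3]; exact ht, h3⟩
  · intro x hx
    exact (Finset.mem_filter.1 hx).2

lemma two_mul_card_points (n : ℕ) : 2 * (points n).card = (n + 1) * (n + 2) := by
  have h := Tri.succ 0
  have e : points n = (points n).filter fun x => x 0 ∈ Finset.range (n + 1) := by
    ext x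
    rw [Finset.mem_filter, mem_points]
    refine ⟨fun hx => ⟨hx, ?_⟩, fun hx => hx.1⟩
    rw [h.sum] at hx
    rw [Finset.mem_range]; omega
  rw [e, card_points_of_mem h fun t ht => by have := Finset.mem_range.1 ht; omega]
  rw [Finset.sum_congr rfl (g := fun t => (n + 1) - t)
    fun t ht => by have := Finset.mem_range.1 ht; omega]
  rw [← Finset.sum_range_reflect]
  rw [Finset.sum_congr rfl (g := fun t => t + 1)
    fun t ht => by have := Finset.mem_range.1 ht; omega]
  have e1 := Finset.sum_range_succ' (fun t => t) (n + 1)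
  have e2 := Finset.sum_range_id_mul_two (n + 1 + 1)
  rw [add_zero] at e1
  rw [e1] at e2
  rw [mul_comm, e2]
  simp [mul_comm]

/-- The points below the top direct line that are on no direct line. -/
lemma card_unlabeled_strip (h : Tri i j k) {t : ℕ} (ht : ∀ s ∈ directLines n lab i, s ≤ t) :
    ((unlabeled n lab).filter fun x => x i ≤ t).card ≤
      (t + 1 - (directLines n lab i).card) * (n + 1) := by
  have hsub : directLines n lab i ⊆ Finset.range (t + 1) := fun s hs =>
    Finset.mem_range.2 (by have := ht s hs; omega)
  have := card_le_mul_succ h (n := n) (S := (unlabeled n lab).filter fun x => x i ≤ t)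
    (A := Finset.range (t + 1) \ directLines n lab i)
    (fun x hx => (mem_unlabeled.1 (Finset.mem_filter.1 hx).1).1) fun x hx => by
      obtain ⟨h1, h2⟩ := Finset.mem_filter.1 hx
      obtain ⟨h3, h4⟩ := mem_unlabeled.1 h1
      refine Finset.mem_sdiff.2 ⟨Finset.mem_range.2 (by omega), fun h5 => ?_⟩
      rcases label_of_directLines h h5 h3 rfl with h6 | h6 <;> rw [h4] at h6 <;> cases h6
  rwa [Finset.card_sdiff_of_subset hsub, Finset.card_range] at this

/-- Each unlabeled point lies in one of three strips, where it avoids the direct lines, or in the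
remaining small triangle, which has at most `n + 1 - (ti + tj + tk)` levels. Every level is counted
with the crude size `n + 1`. -/
lemma card_unlabeled_le (h : Tri i j k) {ti tj tk : ℕ}
    (hi : ∀ s ∈ directLines n lab i, s ≤ ti) (hj : ∀ s ∈ directLines n lab j, s ≤ tj)
    (hk : ∀ s ∈ directLines n lab k, s ≤ tk) :
    (unlabeled n lab).card ≤ ((ti + 1 - (directLines n lab i).card) +
      (tj + 1 - (directLines n lab j).card) + (tk + 1 - (directLines n lab k).card) +
      (n + 1 - (ti + tj + tk))) * (n + 1) := by
  set R := (unlabeled n lab).filter fun x => ti ≤ x i ∧ tj ≤ x j ∧ tk ≤ x k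
  have hR : R.card ≤ (n + 1 - (ti + tj + tk)) * (n + 1) := by
    have := card_le_mul_succ h (n := n) (S := R) (A := Finset.Ico ti (n + 1 - (tj + tk)))
      (fun x hx => (mem_unlabeled.1 (Finset.mem_filter.1 hx).1).1) fun x hx => by
        obtain ⟨h1, h2⟩ := Finset.mem_filter.1 hx
        obtain ⟨h3, -⟩ := mem_unlabeled.1 h1
        rw [h.sum] at h3
        rw [Finset.mem_Ico]; omega
    rwa [Nat.card_Ico, Nat.sub_sub, show tj + tk + ti = ti + tj + tk by ring] at this
  have hc : unlabeled n lab ⊆ ((unlabeled n lab).filter fun x => x i ≤ ti) ∪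
      ((unlabeled n lab).filter fun x => x j ≤ tj) ∪
      ((unlabeled n lab).filter fun x => x k ≤ tk) ∪ R := by
    intro x hx
    simp only [R, Finset.mem_union, Finset.mem_filter, hx, true_and]
    omega
  have h1 := Finset.card_le_card hc
  have c1 := card_unlabeled_strip h hi
  have c2 := card_unlabeled_strip h.rot hj
  have c3 := card_unlabeled_strip h.rot.rot hk
  have u1 := Finset.card_union_le (((unlabeled n lab).filter fun x => x i ≤ ti) ∪
      ((unlabeled n lab).filter fun x => x j ≤ tj) ∪
      ((unlabeled n lab).filter fun x => x k ≤ tk)) R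
  have u2 := Finset.card_union_le (((unlabeled n lab).filter fun x => x i ≤ ti) ∪
      ((unlabeled n lab).filter fun x => x j ≤ tj))
      ((unlabeled n lab).filter fun x => x k ≤ tk)
  have u3 := Finset.card_union_le ((unlabeled n lab).filter fun x => x i ≤ ti)
      ((unlabeled n lab).filter fun x => x j ≤ tj)
  rw [add_mul, add_mul, add_mul]
  omega

lemma two_mul_card_unlabeled_le (n : ℕ) (lab : (Fin 3 → ℕ) → Option (Fin 3)) :
    2 * (unlabeled n lab).card ≤ (n + 1) * (n + 2) := by
  rw [← two_mul_card_points]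
  exact Nat.mul_le_mul_left _ (Finset.card_filter_le _ _)

/-! ### Excess over `2 n` in terms of the number of points without a corner label -/

/-- The weighted label changes exceed `2 n` by two thirds of the density of unlabeled points. -/
def HasExcess (n : ℕ) (lab : (Fin 3 → ℕ) → Option (Fin 3)) : Prop :=
  2 * ((unlabeled n lab).card : ℝ) ≤ 3 * n * (totalChanges n lab - 2 * n + 20)

/-- One unit of excess pays for one full line of unlabeled points, because `2 (n + 1) ≤ 3 n` once `n
≥ 2`. -/
lemma hasExcess_of_card_le (hn : 2 ≤ n) {Y : ℕ} (hF : (unlabeled n lab).card ≤ Y * (n + 1))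
    (hY : Y + 2 * n ≤ totalChanges n lab + 20) : HasExcess n lab := by
  have h1 : ((unlabeled n lab).card : ℝ) ≤ Y * (n + 1) := by exact_mod_cast hF
  have h2 : (Y : ℝ) ≤ totalChanges n lab - 2 * n + 20 := by
    have : (Y : ℝ) + 2 * n ≤ totalChanges n lab + 20 := by exact_mod_cast hY
    linarith
  have h3 : (2 : ℝ) ≤ n := by exact_mod_cast hn
  have h4 : 2 * ((Y : ℝ) * (n + 1)) ≤ 3 * n * Y := by
    have : (0 : ℝ) ≤ Y := Nat.cast_nonneg _
    nlinarith
  have h5 : 3 * (n : ℝ) * Y ≤ 3 * n * (totalChanges n lab - 2 * n + 20) :=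
    mul_le_mul_of_nonneg_left h2 (by positivity)
  unfold HasExcess
  linarith

/-- An excess of `n / 3` suffices even if every point is unlabeled, since there are about `n² / 2`
points. This is tight to leading order. -/
lemma hasExcess_of_le (hn : 3 ∣ n) (hn0 : 0 < n) (hT : 7 * (n / 3) ≤ totalChanges n lab + 10) :
    HasExcess n lab := by
  have h1 : 2 * ((unlabeled n lab).card : ℝ) ≤ (n + 1) * (n + 2) := by
    exact_mod_cast two_mul_card_unlabeled_le n lab
  obtain ⟨N, rfl⟩ := hn
  rw [Nat.mul_div_cancel_left _ (by norm_num)] at hT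
  have h2 : 7 * (N : ℝ) ≤ totalChanges (3 * N) lab + 10 := by exact_mod_cast hT
  have h3 : (1 : ℝ) ≤ N := by exact_mod_cast (show 1 ≤ N by omega)
  unfold HasExcess
  push_cast at h1 ⊢
  have h5 : 3 * (3 * (N : ℝ)) * (N + 10) ≤
      3 * (3 * (N : ℝ)) * (totalChanges (3 * N) lab - 2 * (3 * N) + 20) :=
    mul_le_mul_of_nonneg_left (by linarith) (by positivity)
  nlinarith

/-- A direct line has a single switch point, so the largest `x k` at which `j` occurs separates the
two labels. -/
lemma exists_threshold (h : Tri i j k) {t : ℕ} (ht : t ∈ directLines n lab i) :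
    ∃ r, r + t ≤ n ∧ ∀ x : Fin 3 → ℕ, ∑ l, x l = n → x i = t →
      (x k ≤ r → lab x = some j) ∧ (r < x k → lab x = some k) := by
  have htb := directLines_le ht
  obtain ⟨-, h1, -, -⟩ := (mem_directLines h).1 ht
  set A := (Finset.range (n - t + 1)).filter fun u => lab (pt n i k t u) = some j with hA
  have hA0 : (0 : ℕ) ∈ A := by
    rw [hA, Finset.mem_filter, Finset.mem_range]; exact ⟨by omega, h1⟩
  obtain ⟨r, hr, e⟩ := Finset.exists_mem_eq_sup A ⟨0, hA0⟩ id
  have hr' := hr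
  rw [hA, Finset.mem_filter, Finset.mem_range] at hr'
  have hs := sum_pt h.swap (n := n) (t := t) (u := r) (by omega)
  refine ⟨r, by omega, fun x hx hxi => ⟨fun hxr => ?_, fun hxr => ?_⟩⟩
  · rcases label_of_directLines h ht hx hxi with h2 | h2
    · exact h2
    · exfalso
      have := lt_of_directLines h ht hx hxi hs pt_fst h2 hr'.2
      rw [pt_thd h.swap] at this
      have hx' := hx
      rw [h.sum] at hx'
      omega
  · rcases label_of_directLines h ht hx hxi with h2 | h2
    · exfalso
      have hx' := hx
      rw [h.sum] at hx'
      have hm : x k ∈ A := by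
        rw [hA, Finset.mem_filter, Finset.mem_range]
        refine ⟨by omega, ?_⟩
        rw [← eq_pt h.swap hx hxi rfl, h2]
      have : x k ≤ A.sup id := Finset.le_sup (f := id) hm
      rw [e, id] at this
      omega
    · exact h2

/-- The case of direct lines in exactly two directions. -/
lemma hasExcess_of_two (hn : 3 ∣ n) (L : IsLinkedLabeling n lab) (h : Tri i j k)
    (hi : (directLines n lab i).card ≠ 0) (hk : (directLines n lab k).card ≠ 0)
    (hj : (directLines n lab j).card = 0) : HasExcess n lab := by
  have e := totalChanges_add L h
  obtain ⟨ti, i1, i0, i2, -⟩ := exists_top_directLine (n := n) (lab := lab) i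
  obtain ⟨tk, k1, k0, k2, -⟩ := exists_top_directLine (n := n) (lab := lab) k
  have mi := i2 hi
  have mk := k2 hk
  have bi := directLines_le mi
  have bk := directLines_le mk
  have hik := directLines_add_le L h.swap mi mk
  have a1 := le_sideCharge L h.swap
  have a2 := le_sideCharge L h.rot.rot
  have c1 := le_sideCharge_of_nonempty hn L h hk
  have c2 := le_sideCharge_of_nonempty hn L h.rot hi
  -- With few direct lines the excess is already `n / 3`. Otherwise the region beyond both top lines
  -- has `x j ≤ 2 * (n / 3)`, so its lines in direction `j` are among those counted by `slackSum`.
  by_cases hsmall : ti + tk ≤ n / 3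
  · exact hasExcess_of_le hn (by omega) (by omega)
  obtain ⟨ri, ri1, ri2⟩ := exists_threshold h mi
  obtain ⟨rk, rk1, rk2⟩ := exists_threshold h.rot.rot.swap mk
  -- A point of the middle third of the side `x j = 0` is charged as soon as the label `k` lies on
  -- its line `x k = t`, or `i` on its line `x i = n - t`. The top direct lines provide this when
  -- `ri < t` or `rk < n - t`, so only `n - rk ≤ t ≤ ri` may fail.
  have hmid : 3 * (n / 3) ≤ sideCharge n lab k j + sideCharge n lab i j +
      (ri + rk + 1 - n) + 1 := by
    have h1 := le_sideCharge_add_sideCharge hn L h.swap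
    have h2 : Finset.Ioo (n / 3) (2 * (n / 3)) ⊆
        (Finset.Ioo (n / 3) (2 * (n / 3))).filter (fun t => ri < t ∨ rk < n - t) ∪
          Finset.Icc (n - rk) ri := by
      intro t ht
      simp only [Finset.mem_union, Finset.mem_filter, ht, true_and, Finset.mem_Icc]
      have := Finset.mem_Ioo.1 ht
      omega
    have h3 := (Finset.card_le_card h2).trans (Finset.card_union_le _ _)
    rw [Nat.card_Ioo, Nat.card_Icc] at h3
    have h4 : ((Finset.Ioo (n / 3) (2 * (n / 3))).filter
        (fun t => ri < t ∨ rk < n - t)).card ≤ ∑ t ∈ Finset.Ioo (n / 3) (2 * (n / 3)),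
          (charge n lab k j t + charge n lab i j (n - t)) := by
      rw [Finset.card_filter]
      refine Finset.sum_le_sum fun t ht => ?_
      have htb := Finset.mem_Ioo.1 ht
      split_ifs with h5
      · rcases h5 with h5 | h5
        · have : ∃ x : Fin 3 → ℕ, ∑ l, x l = n ∧ x k = t ∧ lab x = some k := by
            by_cases h6 : ti + t ≤ n
            · have hs := sum_pt h.swap (n := n) (t := ti) (u := t) h6
              exact ⟨_, hs, pt_snd h.swap, (ri2 _ hs pt_fst).2 (by rw [pt_snd h.swap]; exact h5)⟩
            · obtain ⟨-, -, h7, -⟩ := (mem_directLines h).1 mi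
              exact L.link_self _ k t (sum_pt (n := n) h (t := ti) (u := 0) (by omega)) h7
                (by rw [pt_thd h]; omega) (by omega)
          obtain ⟨x, hx, hxt, hl⟩ := this
          exact one_le_charge_add_charge L h.swap (by omega) hx (Or.inl hxt) (by rw [hl]; simp)
            (by rw [hl]; simpa using h.jk.symm)
        · have : ∃ x : Fin 3 → ℕ, ∑ l, x l = n ∧ x i = n - t ∧ lab x = some i := by
            by_cases h6 : tk + (n - t) ≤ n
            · have hs := sum_pt h.rot.rot (n := n) (t := tk) (u := n - t) h6
              exact ⟨_, hs, pt_snd h.rot.rot,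
                (rk2 _ hs pt_fst).2 (by rw [pt_snd h.rot.rot]; exact h5)⟩
            · obtain ⟨-, h7, -, -⟩ := (mem_directLines h.rot.rot).1 mk
              exact L.link_self _ i (n - t)
                (sum_pt (n := n) h.rot.rot.swap (t := tk) (u := 0) (by omega)) h7
                (by rw [pt_thd h.rot.rot.swap]; omega) (by omega)
          obtain ⟨x, hx, hxt, hl⟩ := this
          exact one_le_charge_add_charge L h.swap (by omega) hx (Or.inr hxt) (by rw [hl]; simp)
            (by rw [hl]; simpa using h.ij)
      · exact Nat.zero_le _
    omega
  have hempty : ∀ s ∈ directLines n lab j, s ≤ 0 := by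
    rw [Finset.card_eq_zero.1 hj]; simp
  by_cases hr : ri + rk < n
  · refine hasExcess_of_card_le (by omega) (card_unlabeled_le h i0 hempty k0) ?_
    omega
  -- Above the level `b`, a line in direction `j` meets both top direct lines in their parts labeled
  -- `j`. An unlabeled point in between then costs two changes that no charge uses. The lines up to
  -- `b` are counted in full, which the loss in `hmid` allows because `ti + ri ≤ n` and `tk + rk ≤
  -- n`.
  · set b := max (n - (tk + rk)) (n - (ti + ri)) with hb
    set R := (unlabeled n lab).filter fun x => ti ≤ x i ∧ tk ≤ x k with hR
    set X := (R.filter fun x => b < x j).image fun x => x j with hX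
    have hslack : 2 * X.card ≤ slackSum n lab j := by
      have h1 : X ⊆ Finset.Icc 1 (2 * (n / 3)) := by
        intro s hs
        obtain ⟨z, hz, rfl⟩ := Finset.mem_image.1 hs
        rw [hR, Finset.mem_filter, Finset.mem_filter, mem_unlabeled] at hz
        obtain ⟨⟨⟨h1, -⟩, h2, h3⟩, h4⟩ := hz
        rw [h.sum] at h1
        rw [Finset.mem_Icc]
        omega
      refine le_trans ?_ (Finset.sum_le_sum_of_subset h1)
      rw [mul_comm, ← smul_eq_mul, ← Finset.sum_const]
      refine Finset.sum_le_sum fun s hs => ?_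
      obtain ⟨z, hz, rfl⟩ := Finset.mem_image.1 hs
      rw [hR, Finset.mem_filter, Finset.mem_filter, mem_unlabeled] at hz
      obtain ⟨⟨⟨h1, h0⟩, h2, h3⟩, h4⟩ := hz
      have h1' := h1
      rw [h.sum] at h1'
      have h5 : Tri j i k := ⟨h.ij.symm, h.ik, h.jk⟩
      rw [slack_eq h5]
      have p1 := sum_pt (n := n) h5 (t := z j) (u := ti) (by omega)
      have p2 := sum_pt (n := n) h.rot (t := z j) (u := tk) (by omega)
      have l1 : lab (pt n j i (z j) ti) = some j :=
        (ri2 _ p1 (pt_snd h5)).1 (by rw [pt_thd h5]; omega)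
      have l2 : lab (pt n j k (z j) tk) = some j :=
        (rk2 _ p2 (pt_snd h.rot)).1 (by rw [pt_thd h.rot]; omega)
      have key := differ_add_le_lineChanges (lab := lab) h5 p1 h1 p2 pt_fst rfl pt_fst
        (by rw [pt_snd h5]; exact h2) (by rw [pt_thd h.rot]; omega)
      rw [l1, l2, h0, differ_of_ne (by simp : (some j : Option (Fin 3)) ≠ none),
        differ_of_ne (by simp : none ≠ (some j : Option (Fin 3)))] at key
      have g1 : charge n lab j i (z j) ≤ differ (lab (pt n j i (z j) 0)) (some j) := by
        unfold charge differ
        split_ifs <;> first | omega | tauto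
      have g2 : charge n lab j k (z j) ≤ differ (some j) (lab (pt n j k (z j) 0)) := by
        rw [differ_comm]
        unfold charge differ
        split_ifs <;> first | omega | tauto
      omega
    have hcard : (unlabeled n lab).card ≤ ((ti + 1 - (directLines n lab i).card) +
        (tk + 1 - (directLines n lab k).card) + (b + 1) + X.card) * (n + 1) := by
      have hc : unlabeled n lab ⊆ ((unlabeled n lab).filter fun x => x i ≤ ti) ∪
          ((unlabeled n lab).filter fun x => x k ≤ tk) ∪
          ((unlabeled n lab).filter fun x => x j ≤ b) ∪ R.filter fun x => b < x j := by
        intro x hx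
        simp only [hR, Finset.mem_union, Finset.mem_filter, hx, true_and]
        omega
      have h1 := Finset.card_le_card hc
      have c1 := card_unlabeled_strip h i0
      have c3 := card_unlabeled_strip h.rot.rot k0
      have c2 := card_unlabeled_strip h.rot (t := b) (fun s hs => by have := hempty s hs; omega)
      have c4 := card_le_mul_succ h.rot (n := n) (S := R.filter fun x => b < x j) (A := X)
        (fun x hx => (mem_unlabeled.1 (Finset.mem_filter.1 (Finset.mem_filter.1 hx).1).1).1)
        fun x hx => Finset.mem_image_of_mem _ hx
      have u1 := Finset.card_union_le (((unlabeled n lab).filter fun x => x i ≤ ti) ∪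
          ((unlabeled n lab).filter fun x => x k ≤ tk) ∪
          ((unlabeled n lab).filter fun x => x j ≤ b)) (R.filter fun x => b < x j)
      have u2 := Finset.card_union_le (((unlabeled n lab).filter fun x => x i ≤ ti) ∪
          ((unlabeled n lab).filter fun x => x k ≤ tk))
          ((unlabeled n lab).filter fun x => x j ≤ b)
      have u3 := Finset.card_union_le ((unlabeled n lab).filter fun x => x i ≤ ti)
          ((unlabeled n lab).filter fun x => x k ≤ tk)
      rw [hj, Nat.sub_zero] at c2
      rw [add_mul, add_mul, add_mul]
      omega
    refine hasExcess_of_card_le (by omega) hcard ?_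
    omega

end MultiwayCut

end

noncomputable section

open scoped Classical

namespace MultiwayCut

variable {n : ℕ} {lab : (Fin 3 → ℕ) → Option (Fin 3)} {i j k : Fin 3}

/-! ### Labelings with a single label change on some side -/

lemma label_of_one_change (L : IsLinkedLabeling n lab) (h : Tri i j k)
    (hk : lineChanges n lab k 0 ≤ 1) {x : Fin 3 → ℕ} (hx : ∑ l, x l = n) (hxk : x k = 0) :
    lab x = some i ∨ lab x = some j := by
  by_contra! hc
  have := differ_add_differ_le_lineChanges (lab := lab) h.rot.rot hx hxk
  rw [pt_zero_zero h.rot, pt_zero_zero h.swap, L.corner, L.corner, differ_of_ne hc.1,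
    differ_of_ne hc.2.symm] at this
  omega

lemma lt_of_one_change (L : IsLinkedLabeling n lab) (h : Tri i j k)
    (hk : lineChanges n lab k 0 ≤ 1) {x y : Fin 3 → ℕ} (hx : ∑ l, x l = n) (hxk : x k = 0)
    (hy : ∑ l, y l = n) (hyk : y k = 0) (hlx : lab x = some i) (hly : lab y = some j) :
    y i < x i := by
  by_contra! hc
  have := differ_add_le_lineChanges (lab := lab) h.rot.rot hx hy hy hxk hyk hyk hc le_rfl
  have hij : (some i : Option (Fin 3)) ≠ some j := by simpa using h.ij
  rw [pt_zero_zero h.rot, pt_zero_zero h.swap, L.corner, L.corner, hlx, hly, differ_of_ne hij,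
    differ_of_ne hij.symm] at this
  omega

/-- The case of direct lines in one direction only, towards a side with a single label change. -/
lemma hasExcess_of_one (hn : 3 ∣ n) (L : IsLinkedLabeling n lab) (h : Tri i j k)
    (hone : lineChanges n lab k 0 ≤ 1) (hk : (directLines n lab k).card ≠ 0)
    (hi : (directLines n lab i).card = 0) (hj : (directLines n lab j).card = 0) :
    HasExcess n lab := by
  have e := totalChanges_add L h
  have c1 := le_sideCharge_of_nonempty hn L h hk
  have b1 := le_sideCharge_add_sideCharge hn L h.swap
  have b2 := le_sideCharge_add_sideCharge hn L h.rot
  set J := Finset.Ioo (n / 3) (2 * (n / 3)) with hJ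
  set D := directLines n lab k with hD
  set D' := D.filter fun t => 2 * t ≤ n with hD'
  set a : ℕ → ℕ := fun t => if lab (pt n i k (n - t) 0) = some i then 1 else 0 with ha
  set b : ℕ → ℕ := fun t => if lab (pt n j k (n - t) 0) = some j then 1 else 0 with hb
  have hpt : ∀ t ≤ n, pt n j k t 0 = pt n i k (n - t) 0 := fun t ht =>
    eq_pt h.swap (sum_pt h.rot (by omega)) (by rw [pt_thd h.rot]; omega) (pt_snd h.rot)
  have hab : ∀ t ∈ J, 1 ≤ a t + b (n - t) := by
    intro t ht
    have := Finset.mem_Ioo.1 ht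
    simp only [ha, hb]
    rw [show n - (n - t) = t by omega, hpt t (by omega)]
    rcases label_of_one_change L h hone (sum_pt h.swap (t := n - t) (u := 0) (by omega))
      (pt_snd h.swap) with h1 | h1
    · rw [if_pos h1]; omega
    · rw [if_pos h1]; omega
  have hsum : n / 3 ≤ ∑ t ∈ J, a t + ∑ t ∈ J, b t + 1 := by
    rw [← sum_reflect_Ioo hn b, ← Finset.sum_add_distrib]
    have := Finset.sum_le_sum hab
    rw [Finset.sum_const, Nat.card_Ioo, smul_eq_mul] at this
    omega
  -- On the two sides other than `x k = 0`, consider the points at level `x k = t`. The label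
  -- counted by `a t` or `b t` gives a charge on the corresponding side, and a direct line gives a
  -- charge on both. The sum can exceed the charges only if `a t`, `b t` and `t ∈ D` all hold. By
  -- `q4` this requires `2 t ≤ n`, which is the reason for `D'`.
  have hpoint : ∀ t ∈ J, a t + b t + (if t ∈ D then 1 else 0) ≤
      (charge n lab k j t + charge n lab i j (n - t)) +
      (charge n lab k i t + charge n lab j i (n - t)) + if t ∈ D' then 1 else 0 := by
    intro t ht
    have htb := Finset.mem_Ioo.1 ht
    have s1 := sum_pt h.swap (n := n) (t := n - t) (u := 0) (by omega)
    have s2 := sum_pt h.rot (n := n) (t := n - t) (u := 0) (by omega)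
    have q1 : lab (pt n i k (n - t) 0) = some i →
        1 ≤ charge n lab k j t + charge n lab i j (n - t) := fun hl =>
      one_le_charge_add_charge L h.swap (by omega) s1
        (Or.inr pt_fst) (by rw [hl]; simp) (by rw [hl]; simpa using h.ij)
    have q2 : lab (pt n j k (n - t) 0) = some j →
        1 ≤ charge n lab k i t + charge n lab j i (n - t) := fun hl =>
      one_le_charge_add_charge L h.rot (by omega) s2
        (Or.inr pt_fst) (by rw [hl]; simp) (by rw [hl]; simpa using h.ij.symm)
    have q3 : t ∈ D → 1 ≤ charge n lab k j t + charge n lab i j (n - t) ∧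
        1 ≤ charge n lab k i t + charge n lab j i (n - t) := by
      intro hd
      obtain ⟨-, h1, h2, -⟩ := (mem_directLines h.rot.rot).1 hd
      exact ⟨one_le_charge_add_charge L h.swap (by omega)
        (sum_pt h.rot.rot.swap (t := t) (u := 0) (by omega)) (Or.inl pt_fst)
        (by rw [h1]; simp) (by rw [h1]; simpa using h.ij),
        one_le_charge_add_charge L h.rot (by omega)
        (sum_pt h.rot.rot (t := t) (u := 0) (by omega)) (Or.inl pt_fst)
        (by rw [h2]; simp) (by rw [h2]; simpa using h.ij.symm)⟩
    have q4 : n < 2 * t → lab (pt n i k (n - t) 0) = some i →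
        lab (pt n j k (n - t) 0) = some j → False := by
      intro h0 h1 h2
      have := lt_of_one_change L h hone s1 (pt_snd h.swap) s2 (pt_snd h.rot) h1 h2
      rw [pt_fst, pt_thd h.rot] at this
      omega
    have q5 : t ∈ D' ↔ t ∈ D ∧ 2 * t ≤ n := by rw [hD', Finset.mem_filter]
    simp only [ha, hb]
    by_cases x1 : t ∈ D
    · obtain ⟨y1, y2⟩ := q3 x1
      rw [if_pos x1]
      by_cases x2 : 2 * t ≤ n
      · rw [if_pos (q5.2 ⟨x1, x2⟩)]; split_ifs <;> omega
      · split_ifs <;> first | omega | exact (q4 (by omega) ‹_› ‹_›).elim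
    · rw [if_neg x1]
      split_ifs <;> grind
  have hsum2 := Finset.sum_le_sum hpoint
  simp only [Finset.sum_add_distrib] at hsum2 b1 b2
  have eD := Finset.card_filter (fun t => t ∈ D) J
  have eD' := Finset.card_filter (fun t => t ∈ D') J
  have hD1 : D.card ≤ (D.filter fun t => t ≤ n / 3).card + (J.filter fun t => t ∈ D).card + 1 := by
    have : D ⊆ (D.filter fun t => t ≤ n / 3) ∪ (J.filter fun t => t ∈ D) ∪ {2 * (n / 3)} := by
      intro t ht
      have := directLines_le ht
      simp only [hJ, Finset.mem_union, Finset.mem_filter, ht, true_and, and_true, Finset.mem_Ioo,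
        Finset.mem_singleton]
      omega
    refine (Finset.card_le_card this).trans ((Finset.card_union_le _ _).trans ?_)
    exact Nat.add_le_add_right (Finset.card_union_le _ _) _
  have hD2 : (D.filter fun t => t ≤ n / 3).card + (J.filter fun t => t ∈ D').card ≤ D'.card := by
    rw [← Finset.card_union_of_disjoint]
    · refine Finset.card_le_card fun t ht => ?_
      simp only [hD', Finset.mem_union, Finset.mem_filter] at ht ⊢
      rcases ht with ⟨h1, h2⟩ | ⟨-, h1⟩
      · exact ⟨h1, by omega⟩
      · exact h1
    · rw [Finset.disjoint_left]
      intro t ht ht'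
      simp only [hJ, Finset.mem_filter, Finset.mem_Ioo] at ht ht'
      omega
  have hT : 8 * (n / 3) ≤ totalChanges n lab + D'.card + 4 := by omega
  have hn0 : 0 < n := by
    obtain ⟨t, ht⟩ := Finset.card_ne_zero.1 hk
    have := directLines_le ht
    omega
  -- Lines of `D'` lie at level at most `n / 2`, so each has more than `n / 2` points, all labeled.
  -- The loss of `D'.card` in `hT` is therefore compensated by fewer unlabeled points: writing `d`
  -- for this number, to leading order the claim is `n² - d n ≤ 2 n² - 3 d n`, that is `2 d ≤ n`.
  have hF : 2 * (unlabeled n lab).card + D'.card * n ≤ (n + 1) * (n + 2) := by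
    rw [← two_mul_card_points]
    have h1 := card_points_of_mem h.rot.rot (n := n) (A := D') fun t ht => by
      have := (Finset.mem_filter.1 ht).2
      omega
    have h2 : D'.card * n ≤ ∑ t ∈ D', 2 * (n - t + 1) := by
      rw [← smul_eq_mul, ← Finset.sum_const]
      refine Finset.sum_le_sum fun t ht => ?_
      have := (Finset.mem_filter.1 ht).2
      omega
    rw [← Finset.mul_sum, ← h1] at h2
    have h3 : (unlabeled n lab).card + ((points n).filter fun x => x k ∈ D').card ≤
        (points n).card := by
      rw [← Finset.card_union_of_disjoint]
      · refine Finset.card_le_card (Finset.union_subset ?_ ?_) <;> exact Finset.filter_subset _ _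
      · rw [Finset.disjoint_left]
        intro x hx hx'
        obtain ⟨y1, y2⟩ := mem_unlabeled.1 hx
        have y3 := (Finset.mem_filter.1 (Finset.mem_filter.1 hx').2).1
        rcases label_of_directLines h.rot.rot y3 y1 rfl with h6 | h6 <;> rw [y2] at h6 <;> cases h6
    omega
  have hD3 : 2 * D'.card ≤ n := by
    have : D' ⊆ Finset.Icc 1 (n / 2) := fun t ht => by
      obtain ⟨y1, y2⟩ := Finset.mem_filter.1 ht
      have := directLines_le y1
      rw [Finset.mem_Icc]; omega
    have := Finset.card_le_card this
    rw [Nat.card_Icc] at this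
    omega
  generalize D'.card = d at *
  obtain ⟨N, rfl⟩ := hn
  rw [Nat.mul_div_cancel_left _ (by norm_num)] at hT
  have hF' : 2 * ((unlabeled (3 * N) lab).card : ℝ) + d * (3 * N) ≤
      (3 * N + 1) * (3 * N + 2) := by exact_mod_cast hF
  have hT' : 8 * (N : ℝ) ≤ totalChanges (3 * N) lab + d + 4 := by exact_mod_cast hT
  have hd' : 2 * (d : ℝ) ≤ 3 * N := by exact_mod_cast hD3
  have h3 : (1 : ℝ) ≤ N := by exact_mod_cast (show 1 ≤ N by omega)
  unfold HasExcess
  push_cast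
  have h5 : 3 * (3 * (N : ℝ)) * (2 * N - d + 16) ≤
      3 * (3 * (N : ℝ)) * (totalChanges (3 * N) lab - 2 * (3 * N) + 20) :=
    mul_le_mul_of_nonneg_left (by linarith) (by positivity)
  have h6 : 0 ≤ (N : ℝ) * (3 * N - 2 * d) := mul_nonneg (by linarith) (by linarith)
  nlinarith

/-- If some side has a single label change, the weighted label changes exceed `2 n` by two thirds of
the density of unlabeled points. -/
theorem hasExcess_of_one_change (hn : 3 ∣ n) (hn0 : 0 < n) (L : IsLinkedLabeling n lab)
    (h : Tri i j k) (hone : lineChanges n lab k 0 ≤ 1) : HasExcess n lab := by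
  have e := totalChanges_add L h
  have c0 : 3 * (n / 3) ≤ sideCharge n lab j k + sideCharge n lab i k + 1 :=
    le_sideCharge_add_of_forall hn L h fun t ht => by
      have hs := sum_pt h.rot (n := n) (t := t) (u := 0) (by omega)
      rcases label_of_one_change L h hone hs (pt_snd h.rot) with h1 | h1
      · exact one_le_charge_add_charge L h ht hs (Or.inl pt_fst) (by rw [h1]; simp)
          (by rw [h1]; simpa using h.ik)
      · exact one_le_charge_add_charge L h ht hs (Or.inl pt_fst) (by rw [h1]; simp)
          (by rw [h1]; simpa using h.jk)
  have a1 := le_sideCharge L h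
  have a2 := le_sideCharge L h.rot
  have a3 := le_sideCharge L h.rot.rot
  have a4 := le_sideCharge L h.swap
  have a5 := le_sideCharge L h.rot.swap
  have a6 := le_sideCharge L h.rot.rot.swap
  have b1 := card_directLines_le_sideCharge (n := n) (lab := lab) h
  have b2 := card_directLines_le_sideCharge (n := n) (lab := lab) h.rot
  have b3 := card_directLines_le_sideCharge (n := n) (lab := lab) h.rot.rot
  have b4 := card_directLines_le_sideCharge (n := n) (lab := lab) h.swap
  have b5 := card_directLines_le_sideCharge (n := n) (lab := lab) h.rot.swap
  have b6 := card_directLines_le_sideCharge (n := n) (lab := lab) h.rot.rot.swap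
  have c2 := le_sideCharge_of_nonempty hn L h.rot
  have c3 := le_sideCharge_of_nonempty hn L h.rot.rot
  -- The side `x k = 0` is always fully charged here. Without direct lines, or with direct lines
  -- only in direction `i` or only in direction `j`, the excess is already `n / 3`. Only the
  -- direction `k` alone needs the finer count of `hasExcess_of_one`.
  by_cases hi : (directLines n lab i).card = 0
  · by_cases hj : (directLines n lab j).card = 0
    · by_cases hk : (directLines n lab k).card = 0
      · exact hasExcess_of_le hn hn0 (by omega)
      · exact hasExcess_of_one hn L h hone hk hi hj
    · by_cases hk : (directLines n lab k).card = 0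
      · exact hasExcess_of_le hn hn0 (by omega)
      · exact hasExcess_of_two hn L h.rot.rot hk hj hi
  · by_cases hj : (directLines n lab j).card = 0
    · by_cases hk : (directLines n lab k).card = 0
      · exact hasExcess_of_le hn hn0 (by omega)
      · exact hasExcess_of_two hn L h hi hk hj
    · by_cases hk : (directLines n lab k).card = 0
      · exact hasExcess_of_two hn L h.swap hi hj hk
      · obtain ⟨ti, i1, i0, i2, -⟩ := exists_top_directLine (n := n) (lab := lab) i
        obtain ⟨tj, j1, j0, j2, -⟩ := exists_top_directLine (n := n) (lab := lab) j
        obtain ⟨tk, k1, k0, k2, -⟩ := exists_top_directLine (n := n) (lab := lab) k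
        have d := directLines_add_add_le L h (i2 hi) (j2 hj) (k2 hk)
        refine hasExcess_of_card_le (by omega) (card_unlabeled_le h i0 j0 k0) ?_
        have c2 := c2 hi
        have c3 := c3 hj
        omega

end MultiwayCut

end

noncomputable section

open scoped Classical

namespace MultiwayCut

variable {n : ℕ} {lab : (Fin 3 → ℕ) → Option (Fin 3)} {i j k : Fin 3}

/-! ### Sealed corners -/

/-- The boundary of the corner region `x k ≥ n - c` carries the label `k` only. -/
def IsSealed (n : ℕ) (lab : (Fin 3 → ℕ) → Option (Fin 3)) (c : ℕ) (k : Fin 3) : Prop :=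
  ∀ x : Fin 3 → ℕ, ∑ l, x l = n → (x k = n - c ∨ n - c ≤ x k ∧ ∃ l, l ≠ k ∧ x l = 0) →
    lab x = some k

/-- A line `x i = s` through an unlabeled point of a sealed corner reads `k`, unlabeled, `k`, and
ends at a point that cannot be labeled `k`. That is three changes against at most two charges, so
the line has slack, and it has at most `c + 1` points in the corner. -/
lemma card_unlabeled_sealed (hn : 3 ∣ n) (L : IsLinkedLabeling n lab) (h : Tri i j k) {c : ℕ}
    (hc : 2 * c < n) (hk : IsSealed n lab c k) :
    ((unlabeled n lab).filter fun x => n - c ≤ x k).card ≤ slackSum n lab i * (c + 1) := by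
  set A := (Finset.Icc 1 (2 * (n / 3))).filter fun s => 1 ≤ slack n lab i s with hA
  have hAc : A.card ≤ slackSum n lab i := by
    rw [hA, Finset.card_filter]
    exact Finset.sum_le_sum fun s _ => by split_ifs <;> omega
  refine le_trans ?_ (Nat.mul_le_mul_right _ hAc)
  have := card_le_mul h (n := n) (S := (unlabeled n lab).filter fun x => n - c ≤ x k) (A := A)
    (B := Finset.range (c + 1)) (fun x hx => (mem_unlabeled.1 (Finset.mem_filter.1 hx).1).1)
    (fun z hz => ?_) fun z hz => ?_
  · rwa [Finset.card_range] at this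
  · obtain ⟨h1, h2⟩ := Finset.mem_filter.1 hz
    obtain ⟨h3, h4⟩ := mem_unlabeled.1 h1
    have h3' := h3
    rw [h.sum] at h3'
    have hi0 : z i ≠ 0 := fun h0 => by
      rw [hk z h3 (Or.inr ⟨h2, i, h.ik, h0⟩)] at h4; cases h4
    have hkc : z k ≠ n - c := fun h0 => by
      rw [hk z h3 (Or.inl h0)] at h4; cases h4
    refine Finset.mem_filter.2 ⟨Finset.mem_Icc.2 (by omega), ?_⟩
    have p0 := sum_pt h (n := n) (t := z i) (u := 0) (by omega)
    have p1 := sum_pt h.swap (n := n) (t := z i) (u := n - c) (by omega)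
    have l0 : lab (pt n i j (z i) 0) = some k :=
      hk _ p0 (Or.inr ⟨by rw [pt_thd h]; omega, j, h.jk, pt_snd h⟩)
    have l1 : lab (pt n i k (z i) (n - c)) = some k := hk _ p1 (Or.inl (pt_snd h.swap))
    have l2 := side_label L h (show z i ≤ n by omega)
    have key := differ_add_le_lineChanges (lab := lab) h h3 p1 p1 rfl pt_fst pt_fst
      (by rw [pt_thd h.swap]; omega) le_rfl
    rw [l0, l1, h4, differ_of_ne (by simp : (some k : Option (Fin 3)) ≠ none),
      differ_of_ne (by simp : none ≠ (some k : Option (Fin 3))), differ_self,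
      differ_of_ne l2.symm] at key
    rw [slack_eq h]
    have := charge_le_one (n := n) (lab := lab) i j (z i)
    have := charge_le_one (n := n) (lab := lab) i k (z i)
    omega
  · obtain ⟨h1, h2⟩ := Finset.mem_filter.1 hz
    have h3 := (mem_unlabeled.1 h1).1
    rw [h.sum] at h3
    rw [Finset.mem_range]
    omega

lemma two_mul_card_corner (h : Tri i j k) {c : ℕ} (hc : c ≤ n) :
    2 * ((points n).filter fun x => n - c ≤ x i).card = (c + 1) * (c + 2) := by
  have e : ((points n).filter fun x => n - c ≤ x i) =
      (points n).filter fun x => x i ∈ Finset.Icc (n - c) n := by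
    ext x
    simp only [Finset.mem_filter, Finset.mem_Icc, mem_points]
    refine and_congr_right fun hx => ?_
    rw [h.sum] at hx
    omega
  rw [e, card_points_of_mem h fun t ht => (Finset.mem_Icc.1 ht).2, ← two_mul_card_points c]
  have e2 : points c = (points c).filter fun x => x i ∈ Finset.range (c + 1) := by
    ext x
    rw [Finset.mem_filter, mem_points]
    refine ⟨fun hx => ⟨hx, ?_⟩, fun hx => hx.1⟩
    rw [h.sum] at hx
    rw [Finset.mem_range]; omega
  rw [e2, card_points_of_mem h fun t ht => by have := Finset.mem_range.1 ht; omega]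
  congr 1
  refine Finset.sum_nbij' (fun t => t - (n - c)) (fun t => t + (n - c)) ?_ ?_ ?_ ?_ ?_ <;>
    · intro t ht
      simp only [Finset.mem_Icc, Finset.mem_range] at *
      omega

/-- Sealed corners contain few points without a corner label, up to the unused label changes. -/
theorem card_unlabeled_add_le (hn : 3 ∣ n) (L : IsLinkedLabeling n lab) {c : ℕ} (hc : 2 * c < n)
    {K : Finset (Fin 3)} (hK : ∀ k ∈ K, IsSealed n lab c k) :
    2 * (unlabeled n lab).card + K.card * ((c + 1) * (c + 2)) ≤
      (n + 1) * (n + 2) + 2 * ((∑ i, slackSum n lab i) * (c + 1)) := by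
  set out := (points n).filter fun x => ∀ k ∈ K, x k < n - c
  have h1 : out.card + ∑ k ∈ K, ((points n).filter fun x => n - c ≤ x k).card ≤
      (points n).card := by
    rw [← Finset.card_biUnion, ← Finset.card_union_of_disjoint]
    · refine Finset.card_le_card (Finset.union_subset (Finset.filter_subset _ _) ?_)
      exact Finset.biUnion_subset.2 fun k _ => Finset.filter_subset _ _
    · rw [Finset.disjoint_left]
      intro x hx hx'
      obtain ⟨k, hk, hx'⟩ := Finset.mem_biUnion.1 hx'
      have := (Finset.mem_filter.1 hx).2 k hk
      have := (Finset.mem_filter.1 hx').2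
      omega
    · intro k _ l _ hkl
      rw [Function.onFun, Finset.disjoint_left]
      intro x hx hx'
      obtain ⟨m, hm⟩ := Tri.exists_third hkl
      obtain ⟨x1, x2⟩ := Finset.mem_filter.1 hx
      have x3 := (Finset.mem_filter.1 hx').2
      rw [mem_points, hm.sum] at x1
      omega
  have h2 : ∑ k ∈ K, ((points n).filter fun x => n - c ≤ x k).card * 2 =
      K.card * ((c + 1) * (c + 2)) := by
    rw [← smul_eq_mul, ← Finset.sum_const]
    exact Finset.sum_congr rfl fun k _ => by
      rw [mul_comm, two_mul_card_corner (Tri.succ k) (by omega)]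
  rw [← Finset.sum_mul] at h2
  have h3 : (unlabeled n lab).card ≤ out.card +
      ∑ k ∈ K, ((unlabeled n lab).filter fun x => n - c ≤ x k).card := by
    have : unlabeled n lab ⊆ out ∪ K.biUnion fun k => (unlabeled n lab).filter fun x =>
        n - c ≤ x k := by
      intro x hx
      by_cases hx' : ∀ k ∈ K, x k < n - c
      · exact Finset.mem_union_left _
          (Finset.mem_filter.2 ⟨mem_points.2 (mem_unlabeled.1 hx).1, hx'⟩)
      · push Not at hx'
        obtain ⟨k, hk, hx'⟩ := hx'
        exact Finset.mem_union_right _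
          (Finset.mem_biUnion.2 ⟨k, hk, Finset.mem_filter.2 ⟨hx, hx'⟩⟩)
    exact (Finset.card_le_card this).trans ((Finset.card_union_le _ _).trans
      (Nat.add_le_add_left Finset.card_biUnion_le _))
  have h4 : ∑ k ∈ K, ((unlabeled n lab).filter fun x => n - c ≤ x k).card ≤
      (∑ i, slackSum n lab i) * (c + 1) := by
    -- Corner `k` is paid for by the slack in direction `k + 1`, so no slack is used by two corners.
    calc _ ≤ ∑ k ∈ K, slackSum n lab (k + 1) * (c + 1) :=
          Finset.sum_le_sum fun k hk =>
            card_unlabeled_sealed hn L (Tri.succ k).rot hc (hK k hk)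
      _ ≤ ∑ k, slackSum n lab (k + 1) * (c + 1) :=
          Finset.sum_le_sum_of_subset (Finset.subset_univ _)
      _ = (∑ k, slackSum n lab (k + 1)) * (c + 1) := by rw [Finset.sum_mul]
      _ = _ := by
          congr 1
          exact Equiv.sum_comp (Equiv.addRight (1 : Fin 3)) (slackSum n lab)
  have h5 := two_mul_card_points n
  omega

end MultiwayCut

end

/-! ### From cuts of the tetrahedron to linked labelings of the face, and from label changes to cut
edges. -/

noncomputable section

open scoped Classical

namespace MultiwayCut

variable {n : ℕ} {i j k : Fin 3}

/-! ### Face nodes and their labels -/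

/-- The node with given integer coordinates. -/
def Node.ofSum (a : Fin 4 → ℕ) (h : ∑ i, a i = n) : Node n := ⟨a, h⟩

/-- The node of the face with given integer coordinates. -/
def faceNode (n : ℕ) (x : Fin 3 → ℕ) : Node n :=
  if h : ∑ l, x l = n then
    Node.ofSum (Fin.snoc (α := fun _ => ℕ) x 0) (by
      rw [Fin.sum_univ_castSucc]
      simp only [Fin.snoc_castSucc, Fin.snoc_last, add_zero]
      exact h)
  else terminal n 0

lemma faceNode_castSucc {x : Fin 3 → ℕ} (hx : ∑ l, x l = n) (l : Fin 3) :
    (faceNode n x).1 l.castSucc = x l := by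
  rw [faceNode, dif_pos hx]
  exact Fin.snoc_castSucc (α := fun _ => ℕ) _ _ _

lemma faceNode_three {x : Fin 3 → ℕ} (hx : ∑ l, x l = n) : (faceNode n x).1 3 = 0 := by
  rw [faceNode, dif_pos hx]
  exact Fin.snoc_last (n := 3) (α := fun _ => ℕ) 0 x

lemma faceNode_injective {x y : Fin 3 → ℕ} (hx : ∑ l, x l = n) (hy : ∑ l, y l = n)
    (h : faceNode n x = faceNode n y) : x = y := by
  funext l
  rw [← faceNode_castSucc hx, ← faceNode_castSucc hy, h]

lemma faceNode_single (i : Fin 3) : faceNode n (Pi.single i n) = terminal n i.castSucc := by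
  have hs : ∑ l, (Pi.single i n : Fin 3 → ℕ) l = n := by simp
  apply Subtype.ext
  funext l
  refine Fin.lastCases ?_ (fun l => ?_) l
  · rw [show Fin.last 3 = 3 from rfl, faceNode_three hs]
    exact (Pi.single_eq_of_ne (M := fun _ => ℕ) (Fin.castSucc_lt_last i).ne' n).symm
  · rw [faceNode_castSucc hs]
    simp [terminal, Pi.single_apply]

/-- Two neighbouring points of the triangle. -/
def IsStep (x y : Fin 3 → ℕ) : Prop :=
  ∃ i j k, Tri i j k ∧ y i = x i ∧ y j = x j + 1 ∧ x k = y k + 1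

lemma IsStep.symm {x y : Fin 3 → ℕ} (h : IsStep x y) : IsStep y x := by
  obtain ⟨i, j, k, t, h1, h2, h3⟩ := h
  exact ⟨i, k, j, t.swap, h1.symm, h3, h2⟩

lemma IsStep.bounds {x y : Fin 3 → ℕ} (h : IsStep x y) (l : Fin 3) :
    x l ≤ y l + 1 ∧ y l ≤ x l + 1 := by
  obtain ⟨i, j, k, t, h1, h2, h3⟩ := h
  rcases t.eq_or l with rfl | rfl | rfl <;> omega

/-- The corner label of a face point, or `none`. -/
def faceLabel (P : Node n → Fin 5) (x : Fin 3 → ℕ) : Option (Fin 3) :=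
  if h : ∃ i : Fin 3, P (faceNode n x) = i.castSucc.castSucc then some h.choose else none

lemma faceLabel_eq_some {P : Node n → Fin 5} {x : Fin 3 → ℕ} :
    faceLabel P x = some i ↔ P (faceNode n x) = i.castSucc.castSucc := by
  unfold faceLabel
  split_ifs with h
  · have h1 := h.choose_spec
    constructor
    · intro h2
      rw [h1, Option.some.inj h2]
    · intro h2
      exact congrArg some
        (Fin.castSucc_injective _ (Fin.castSucc_injective _ (h1.symm.trans h2)))
  · refine ⟨fun h1 => (by cases h1), fun h1 => absurd ⟨i, h1⟩ h⟩

/-- The points that are joined to the corner `i` through points labeled `i`. -/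
def IsLinked (P : Node n → Fin 5) (i : Fin 3) (x : Fin 3 → ℕ) : Prop :=
  Relation.ReflTransGen (fun x y => ∑ l, x l = n ∧ ∑ l, y l = n ∧ IsStep x y ∧
    faceLabel P x = some i ∧ faceLabel P y = some i) (Pi.single i n) x

/-- The labeling of the face that keeps a corner label only on the points linked to the corner. -/
def linkedLabel (P : Node n → Fin 5) (x : Fin 3 → ℕ) : Option (Fin 3) :=
  if ∃ i, faceLabel P x = some i ∧ IsLinked P i x then faceLabel P x else none

variable {P : Node n → Fin 5}

lemma linkedLabel_eq_some {x : Fin 3 → ℕ} :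
    linkedLabel P x = some i ↔ faceLabel P x = some i ∧ IsLinked P i x := by
  unfold linkedLabel
  split_ifs with h
  · obtain ⟨m, h1, h2⟩ := h
    constructor
    · intro h3
      rw [h1] at h3
      cases h3
      exact ⟨h1, h2⟩
    · exact fun h3 => h3.1
  · exact ⟨fun h1 => (by cases h1), fun h1 => absurd ⟨i, h1⟩ h⟩

lemma faceLabel_single (hP : IsCut P) (i : Fin 3) :
    faceLabel P (Pi.single i n) = some i := by
  rw [faceLabel_eq_some, faceNode_single, hP]

lemma IsLinked.sum_eq {x : Fin 3 → ℕ} (h : IsLinked P i x) : ∑ l, x l = n := by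
  unfold IsLinked at h
  induction h with
  | refl => simp
  | tail _ h2 _ => exact h2.2.1

lemma IsLinked.linkedLabel_eq (hP : IsCut P) {x : Fin 3 → ℕ} (h : IsLinked P i x) :
    linkedLabel P x = some i := by
  refine linkedLabel_eq_some.2 ⟨?_, h⟩
  unfold IsLinked at h
  cases h with
  | refl => exact faceLabel_single hP i
  | tail _ h2 => exact h2.2.2.2.2

/-- Non-opposite cuts give the support condition. The linking condition is a discrete intermediate
value argument: along a path to the corner the `i`-th coordinate changes by at most one per step. -/
lemma isLinkedLabeling_linkedLabel (hP : IsCut P) (hO : IsNonOpposite P) :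
    IsLinkedLabeling n (linkedLabel P) where
  support x i hx hl h0 := by
    have h1 := faceLabel_eq_some.1 (linkedLabel_eq_some.1 hl).1
    rcases hO (faceNode n x) with ⟨m, hm, hm2⟩ | h2
    · rw [h1] at hm2
      rw [← Fin.castSucc_injective _ hm2] at hm
      simp [support, coord, faceNode_castSucc hx, h0] at hm
    · rw [h1] at h2
      exact (Fin.castSucc_lt_last _).ne h2
  corner i := (show IsLinked P i _ from Relation.ReflTransGen.refl).linkedLabel_eq hP
  link_self x i v hx hl h1 h2 := by
    have h := (linkedLabel_eq_some.1 hl).2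
    suffices H : ∀ x, IsLinked P i x → ∀ v, x i ≤ v → v ≤ n →
        ∃ y : Fin 3 → ℕ, ∑ l, y l = n ∧ y i = v ∧ linkedLabel P y = some i from
      H x h v h1 h2
    intro x hx
    have hx' := hx
    unfold IsLinked at hx
    induction hx with
    | refl =>
      intro v h1 h2
      refine ⟨_, hx'.sum_eq, ?_, hx'.linkedLabel_eq hP⟩
      simp only [Pi.single_eq_same] at *
      omega
    | @tail b c ha hb ih =>
      intro v h1 h2
      have := hb.2.2.1.bounds i
      by_cases h3 : v = c i
      · exact ⟨c, hx'.sum_eq, h3.symm, hx'.linkedLabel_eq hP⟩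
      · exact ih ha v (by omega) h2

/-- Restricting the corner labels to linked points creates no new label changes. -/
lemma ne_of_linkedLabel_ne {x y : Fin 3 → ℕ} (hx : ∑ l, x l = n) (hy : ∑ l, y l = n)
    (hs : IsStep x y) (h : linkedLabel P x ≠ linkedLabel P y) :
    P (faceNode n x) ≠ P (faceNode n y) := by
  intro e
  have e1 : ∀ i, faceLabel P x = some i ↔ faceLabel P y = some i := fun i => by
    rw [faceLabel_eq_some, faceLabel_eq_some, e]
  apply h
  ext i
  rw [linkedLabel_eq_some, linkedLabel_eq_some]
  constructor
  · rintro ⟨h1, h2⟩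
    exact ⟨(e1 i).1 h1, h2.tail ⟨hx, hy, hs, h1, (e1 i).1 h1⟩⟩
  · rintro ⟨h1, h2⟩
    exact ⟨(e1 i).2 h1, h2.tail ⟨hy, hx, hs.symm, h1, (e1 i).2 h1⟩⟩

/-! ### The edges of the face -/

lemma adj_faceNode (hn : 0 < n) {x y : Fin 3 → ℕ} (hx : ∑ l, x l = n) (hy : ∑ l, y l = n)
    (hs : IsStep x y) : (graph n).Adj (faceNode n x) (faceNode n y) := by
  obtain ⟨i, j, k, h, h1, h2, h3⟩ := hs
  have hn' : (0 : ℝ) < n := by exact_mod_cast hn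
  refine ⟨fun e => ?_, ?_⟩
  · have := congrFun (faceNode_injective hx hy e) j
    omega
  · have e3 : coord (faceNode n x) (Fin.last 3) - coord (faceNode n y) (Fin.last 3) = 0 := by
      simp [coord, show Fin.last 3 = (3 : Fin 4) from rfl, faceNode_three hx, faceNode_three hy]
    have hu : (Finset.univ : Finset (Fin 3)) = {i, j, k} := by
      ext l; simpa using h.eq_or l
    rw [Fin.sum_univ_castSucc, e3, hu, Finset.sum_insert (by simp [h.ij, h.ik]),
      Finset.sum_insert (by simp [h.jk]), Finset.sum_singleton]
    simp only [coord, faceNode_castSucc hx, faceNode_castSucc hy, h1, h2, h3]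
    push_cast
    rw [sub_self, abs_zero, show (x j : ℝ) / n - ((x j : ℝ) + 1) / n = -(1 / n) by ring,
      show ((y k : ℝ) + 1) / n - (y k : ℝ) / n = 1 / n by ring, abs_neg,
      abs_of_pos (by positivity)]
    ring

/-- The end-nodes of the edges on the lines of the face. -/
lemma isStep_pt (h : Tri i j k) {t u : ℕ} (htu : t + u < n) :
    IsStep (pt n i j t u) (pt n i j t (u + 1)) :=
  ⟨i, j, k, h, by rw [pt_fst, pt_fst], by rw [pt_snd h, pt_snd h],
    by rw [pt_thd h, pt_thd h]; omega⟩

/-- The edge number `u` on the line `x i = t` of the face. -/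
def lineEdge (n : ℕ) (i : Fin 3) (t u : ℕ) : Sym2 (Node n) :=
  s(faceNode n (pt n i (i + 1) t u), faceNode n (pt n i (i + 1) t (u + 1)))

/-- The index `i` is the only coordinate in which the two end-nodes agree. Injectivity ensures that
`sum_lineCost_le_cost` counts no edge twice. -/
lemma lineEdge_injective {i i' : Fin 3} {t t' u u' : ℕ} (h : t + u < n) (h' : t' + u' < n)
    (e : lineEdge n i t u = lineEdge n i' t' u') : i = i' ∧ t = t' ∧ u = u' := by
  have hs := Tri.succ i
  have hs' := Tri.succ i'
  have p1 := sum_pt hs (n := n) (t := t) (u := u) (by omega)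
  have p2 := sum_pt hs (n := n) (t := t) (u := u + 1) (by omega)
  have p1' := sum_pt hs' (n := n) (t := t') (u := u') (by omega)
  have p2' := sum_pt hs' (n := n) (t := t') (u := u' + 1) (by omega)
  have key : ∀ l, pt n i (i + 1) t u l = pt n i (i + 1) t (u + 1) l → l = i := by
    intro l hl
    rcases hs.eq_or l with h1 | h1 | h1
    · exact h1
    · rw [h1, pt_snd hs, pt_snd hs] at hl; omega
    · rw [h1, pt_thd hs, pt_thd hs] at hl; omega
  rcases Sym2.eq_iff.1 e with ⟨e1, e2⟩ | ⟨e1, e2⟩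
  · have e1 := faceNode_injective p1 p1' e1
    have e2 := faceNode_injective p2 p2' e2
    have hi : i' = i := key i' (by rw [e1, e2, pt_fst, pt_fst])
    subst hi
    refine ⟨rfl, ?_, ?_⟩
    · simpa [pt_fst] using congrFun e1 i'
    · simpa [pt_snd hs] using congrFun e1 (i' + 1)
  · have e1 := faceNode_injective p1 p2' e1
    have e2 := faceNode_injective p2 p1' e2
    have hi : i' = i := key i' (by rw [e1, e2, pt_fst, pt_fst])
    subst hi
    have q1 := congrFun e1 (i' + 1)
    have q2 := congrFun e2 (i' + 1)
    rw [pt_snd hs, pt_snd hs] at q1 q2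
    omega

lemma lineEdge_mem_cutSet {i : Fin 3} {t u : ℕ} (h : t + u < n)
    (hl : linkedLabel P (pt n i (i + 1) t u) ≠ linkedLabel P (pt n i (i + 1) t (u + 1))) :
    lineEdge n i t u ∈ cutSet P := by
  have hs := Tri.succ i
  have p1 := sum_pt hs (n := n) (t := t) (u := u) (by omega)
  have p2 := sum_pt hs (n := n) (t := t) (u := u + 1) (by omega)
  exact ⟨_, _, rfl, adj_faceNode (by omega) p1 p2 (isStep_pt hs h),
    ne_of_linkedLabel_ne p1 p2 (isStep_pt hs h) hl⟩

/-- The weight of the edges of a line of the face with a label change. -/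
def lineCost (w : Sym2 (Node n) → ℝ) (P : Node n → Fin 5) (i : Fin 3) (t : ℕ) : ℝ :=
  ∑ u ∈ Finset.range (n - t), w (lineEdge n i t u) *
    differ (linkedLabel P (pt n i (i + 1) t u)) (linkedLabel P (pt n i (i + 1) t (u + 1)))

lemma lineCost_nonneg {w : Sym2 (Node n) → ℝ} (hw : ∀ e, 0 ≤ w e) (i : Fin 3) (t : ℕ) :
    0 ≤ lineCost w P i t :=
  Finset.sum_nonneg fun _ _ => mul_nonneg (hw _) (Nat.cast_nonneg _)

/-- A cut costs at least as much as the label changes on the lines of the face. -/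
lemma sum_lineCost_le_cost {w : Sym2 (Node n) → ℝ} (hw : ∀ e, 0 ≤ w e) (P : Node n → Fin 5) :
    ∑ i, ∑ t ∈ Finset.range n, lineCost w P i t ≤ cost w P := by
  set J : Finset (Fin 3 × ℕ × ℕ) :=
    (Finset.univ ×ˢ (Finset.range n ×ˢ Finset.range n)).filter fun p => p.2.1 + p.2.2 < n ∧
      linkedLabel P (pt n p.1 (p.1 + 1) p.2.1 p.2.2) ≠
        linkedLabel P (pt n p.1 (p.1 + 1) p.2.1 (p.2.2 + 1))
  have h1 : ∑ i, ∑ t ∈ Finset.range n, lineCost w P i t =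
      ∑ p ∈ J, w (lineEdge n p.1 p.2.1 p.2.2) := by
    rw [Finset.sum_filter, Finset.sum_product]
    refine Finset.sum_congr rfl fun i _ => ?_
    rw [Finset.sum_product]
    refine Finset.sum_congr rfl fun t ht => ?_
    have ht := Finset.mem_range.1 ht
    have : Finset.range (n - t) = (Finset.range n).filter fun u => t + u < n := by
      ext u
      simp only [Finset.mem_range, Finset.mem_filter]
      omega
    rw [lineCost, this, Finset.sum_filter]
    refine Finset.sum_congr rfl fun u _ => ?_
    unfold differ
    by_cases q1 : t + u < n
    · by_cases q2 : linkedLabel P (pt n i (i + 1) t u) = linkedLabel P (pt n i (i + 1) t (u + 1))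
      · simp [q2]
      · simp [q1, q2]
    · simp [q1]
  rw [h1, cost]
  rw [← Finset.sum_image (s := J) (f := w) (g := fun p => lineEdge n p.1 p.2.1 p.2.2)]
  · refine Finset.sum_le_sum_of_subset_of_nonneg (fun e he => ?_) fun e _ _ => hw e
    obtain ⟨p, hp, rfl⟩ := Finset.mem_image.1 he
    have hp := (Finset.mem_filter.1 hp).2
    exact Finset.mem_filter.2 ⟨Finset.mem_univ _, lineEdge_mem_cutSet hp.1 hp.2⟩
  · rintro ⟨i, t, u⟩ hp ⟨i', t', u'⟩ hp' e
    have hp := (Finset.mem_filter.1 hp).2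
    have hp' := (Finset.mem_filter.1 hp').2
    obtain ⟨rfl, rfl, rfl⟩ := lineEdge_injective hp.1 hp'.1 e
    rfl

lemma lineCost_ge {w : Sym2 (Node n) → ℝ} {i : Fin 3} {t : ℕ} {r : ℝ}
    (hw : ∀ u, t + u < n → r ≤ w (lineEdge n i t u)) :
    r * lineChanges n (linkedLabel P) i t ≤ lineCost w P i t := by
  rw [lineChanges, changes_eq_sum, lineCost, ← Finset.range_eq_Ico, Nat.cast_sum, Finset.mul_sum]
  refine Finset.sum_le_sum fun u hu => ?_
  have := Finset.mem_range.1 hu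
  exact mul_le_mul_of_nonneg_right (hw u (by omega)) (Nat.cast_nonneg _)

end MultiwayCut

end

/-! ### Edge weights on the lines of the face, and the bounds for the first two instances. -/

noncomputable section

open scoped Classical

namespace MultiwayCut

variable {n : ℕ} {i j k : Fin 3} {P : Node n → Fin 5}

/-! ### Membership in the parts of the graph -/

lemma mem_inducedEdges {S : Set (Node n)} {a b : Node n} :
    s(a, b) ∈ inducedEdges S ↔ (graph n).Adj a b ∧ a ∈ S ∧ b ∈ S := by
  simp [inducedEdges, SimpleGraph.mem_edgeSet]

lemma coord_eq_zero (hn : 0 < n) {a : Node n} {m : Fin 4} : coord a m = 0 ↔ a.1 m = 0 := by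
  have : (n : ℝ) ≠ 0 := by exact_mod_cast hn.ne'
  simp [coord, this]

lemma two_thirds_lt_coord (hn : 3 ∣ n) (hn0 : 0 < n) {a : Node n} {m : Fin 4} :
    2 / 3 < coord a m ↔ 2 * (n / 3) < a.1 m := by
  have h0 : (0 : ℝ) < n := by exact_mod_cast hn0
  obtain ⟨N, rfl⟩ := hn
  rw [Nat.mul_div_cancel_left _ (by norm_num), coord, lt_div_iff₀ h0]
  push_cast
  rw [show 2 / 3 * (3 * (N : ℝ)) = 2 * N by ring]
  exact_mod_cast Iff.rfl

lemma coord_faceNode {x : Fin 3 → ℕ} (hx : ∑ l, x l = n) (l : Fin 3) :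
    coord (faceNode n x) l.castSucc = x l / n := by
  rw [coord, faceNode_castSucc hx]

lemma faceNode_mem_face {x : Fin 3 → ℕ} (hx : ∑ l, x l = n) : faceNode n x ∈ face n := by
  simp [face, coord, faceNode_three hx]

lemma ne_three_iff {m : Fin 4} : m ≠ 3 ↔ ∃ l : Fin 3, m = l.castSucc := by
  revert m; decide

lemma faceNode_mem_hexagon (hn : 3 ∣ n) (hn0 : 0 < n) {x : Fin 3 → ℕ} (hx : ∑ l, x l = n) :
    faceNode n x ∈ hexagon n ↔ ∀ l, x l ≤ 2 * (n / 3) := by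
  have key : ∀ l : Fin 3, coord (faceNode n x) l.castSucc ≤ 2 / 3 ↔ x l ≤ 2 * (n / 3) := by
    intro l
    rw [← not_lt, two_thirds_lt_coord hn hn0, faceNode_castSucc hx, not_lt]
  constructor
  · exact fun h l => (key l).1 (h.2 _ (ne_three_iff.2 ⟨l, rfl⟩))
  · refine fun h => ⟨faceNode_mem_face hx, fun m hm => ?_⟩
    obtain ⟨l, rfl⟩ := ne_three_iff.1 hm
    exact (key l).2 (h l)

lemma mem_cornerEdges (hn : 3 ∣ n) (hn0 : 0 < n) {x y : Fin 3 → ℕ} (hx : ∑ l, x l = n)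
    (hy : ∑ l, y l = n) (hs : IsStep x y) (l : Fin 3) :
    s(faceNode n x, faceNode n y) ∈ cornerEdges n l.castSucc ↔
      2 * (n / 3) < x l ∨ 2 * (n / 3) < y l := by
  have h1 : s(faceNode n x, faceNode n y) ∈ inducedEdges (face n) :=
    mem_inducedEdges.2 ⟨adj_faceNode hn0 hx hy hs, faceNode_mem_face hx, faceNode_mem_face hy⟩
  simp only [cornerEdges, Set.mem_ofPred_eq, h1, true_and, Sym2.mem_iff, two_thirds_lt_coord hn hn0]
  constructor
  · rintro ⟨a, rfl | rfl, h⟩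
    · exact Or.inl (by rwa [faceNode_castSucc hx] at h)
    · exact Or.inr (by rwa [faceNode_castSucc hy] at h)
  · rintro (h | h)
    · exact ⟨_, Or.inl rfl, by rwa [faceNode_castSucc hx]⟩
    · exact ⟨_, Or.inr rfl, by rwa [faceNode_castSucc hy]⟩

lemma faceNode_mem_sideNodes (hn0 : 0 < n) (h : Tri i j k) {x : Fin 3 → ℕ} (hx : ∑ l, x l = n) :
    faceNode n x ∈ sideNodes n i.castSucc j.castSucc ↔ x k = 0 := by
  have h0 : ∀ l : Fin 3, l.castSucc ∈ support (faceNode n x) ↔ x l ≠ 0 := fun l => by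
    rw [support, Set.mem_ofPred_eq, Ne, coord_eq_zero hn0, faceNode_castSucc hx]
  constructor
  · intro h1
    by_contra h2
    rcases h1 ((h0 k).2 h2) with h3 | h3
    · exact h.ik (Fin.castSucc_injective _ h3).symm
    · exact h.jk (Fin.castSucc_injective _ h3).symm
  · intro h1 m hm
    have h3 : m ≠ 3 := by
      rintro rfl
      exact hm ((coord_eq_zero hn0).2 (faceNode_three hx))
    obtain ⟨l, rfl⟩ := ne_three_iff.1 h3
    rcases h.eq_or l with rfl | rfl | rfl
    · exact Or.inl rfl
    · exact Or.inr rfl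
    · exact absurd h1 ((h0 l).1 hm)

lemma mem_boundaryEdges (hn0 : 0 < n) {x y : Fin 3 → ℕ} (hx : ∑ l, x l = n)
    (hy : ∑ l, y l = n) (hs : IsStep x y) :
    s(faceNode n x, faceNode n y) ∈ boundaryEdges n ↔ ∃ l, x l = 0 ∧ y l = 0 := by
  have key : ∀ i j k : Fin 3, Tri i j k → (s(faceNode n x, faceNode n y) ∈
      sideEdges n i.castSucc j.castSucc ↔ x k = 0 ∧ y k = 0) := fun i j k h => by
    rw [sideEdges, mem_inducedEdges, faceNode_mem_sideNodes hn0 h hx,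
      faceNode_mem_sideNodes hn0 h hy]
    exact and_iff_right (adj_faceNode hn0 hx hy hs)
  have c0 : (0 : Fin 3).castSucc = (0 : Fin 4) := rfl
  have c1 : (1 : Fin 3).castSucc = (1 : Fin 4) := rfl
  have c2 : (2 : Fin 3).castSucc = (2 : Fin 4) := rfl
  have k1 := key 0 1 2 ⟨by decide, by decide, by decide⟩
  have k2 := key 0 2 1 ⟨by decide, by decide, by decide⟩
  have k3 := key 1 2 0 ⟨by decide, by decide, by decide⟩
  rw [c0, c1] at k1
  rw [c0, c2] at k2
  rw [c1, c2] at k3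
  rw [boundaryEdges, Set.mem_union, Set.mem_union, k1, k2, k3, Fin.exists_fin_succ,
    Fin.exists_fin_two]
  simp only [Fin.succ_zero_eq_one, Fin.succ_one_eq_two]
  tauto

/-! ### The first instance -/

lemma rho_nonneg (n : ℕ) : 0 ≤ rho n := by unfold rho; positivity

lemma instance1_nonneg (e : Sym2 (Node n)) : 0 ≤ instance1 e := by
  have key : ∀ i, e ∈ cornerEdges n i → 0 ≤ cornerWeight i e := by
    rintro i ⟨-, a, ha, h⟩
    unfold cornerWeight
    split_ifs
    · refine mul_nonneg ?_ (rho_nonneg n)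
      have : coord a i ≤ (e.map fun x => coord x i).sup := by
        induction e with
        | _ u v =>
          rw [Sym2.map_mk, Sym2.sup_mk]
          rcases Sym2.mem_iff.1 ha with rfl | rfl
          · exact le_sup_left
          · exact le_sup_right
      unfold stepsFrom
      have hn : (0 : ℝ) ≤ n := Nat.cast_nonneg _
      nlinarith
    · exact le_rfl
    · exact rho_nonneg n
  unfold instance1
  split_ifs with h1 h2 h3 h4
  · exact rho_nonneg n
  · exact key _ h2
  · exact key _ h3
  · exact key _ h4
  · exact le_rfl

lemma instance1_eq_cornerWeight {e : Sym2 (Node n)} (h : e ∉ inducedEdges (hexagon n))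
    {l : Fin 3} (hl : e ∈ cornerEdges n l.castSucc)
    (hm : ∀ m : Fin 3, m ≠ l → e ∉ cornerEdges n m.castSucc) :
    instance1 e = cornerWeight l.castSucc e := by
  have h0 := hm 0
  have h1 := hm 1
  have c0 : (0 : Fin 3).castSucc = (0 : Fin 4) := rfl
  have c1 : (1 : Fin 3).castSucc = (1 : Fin 4) := rfl
  have c2 : (2 : Fin 3).castSucc = (2 : Fin 4) := rfl
  rw [c0] at h0
  rw [c1] at h1
  have hl3 : l = 0 ∨ l = 1 ∨ l = 2 := by clear hl hm h0 h1; revert l; decide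
  unfold instance1
  rcases hl3 with rfl | rfl | rfl
  · rw [c0] at *
    rw [if_neg h, if_pos hl]
  · rw [c1] at *
    rw [if_neg h, if_neg (h0 (by decide)), if_pos hl]
  · rw [c2] at *
    rw [if_neg h, if_neg (h0 (by decide)), if_neg (h1 (by decide)), if_pos hl]

/-- Near a corner of the face only the weights of that corner apply. -/
lemma instance1_eq_cornerWeight_of_lt (hn : 3 ∣ n) (hn0 : 0 < n) (h : Tri i j k)
    {x y : Fin 3 → ℕ} (hx : ∑ l, x l = n) (hy : ∑ l, y l = n) (hi : y i = x i)
    (hj : y j = x j + 1) (hk : x k = y k + 1) (hlt : 2 * (n / 3) < y j) :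
    instance1 s(faceNode n x, faceNode n y) =
      cornerWeight j.castSucc s(faceNode n x, faceNode n y) := by
  have hs : IsStep x y := ⟨i, j, k, h, hi, hj, hk⟩
  have hx' := hx
  have hy' := hy
  rw [h.sum] at hx' hy'
  refine instance1_eq_cornerWeight (fun hh => ?_)
    ((mem_cornerEdges hn hn0 hx hy hs j).2 (Or.inr hlt)) fun m hm hh => ?_
  · have := (faceNode_mem_hexagon hn hn0 hy).1 (mem_inducedEdges.1 hh).2.2 j
    omega
  · rw [mem_cornerEdges hn hn0 hx hy hs] at hh
    rcases h.eq_or m with rfl | rfl | rfl <;> omega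

lemma instance1_of_interior (hn : 3 ∣ n) (hn0 : 0 < n) (h : Tri i j k) {x y : Fin 3 → ℕ}
    (hx : ∑ l, x l = n) (hy : ∑ l, y l = n) (hi : y i = x i) (hj : y j = x j + 1)
    (hk : x k = y k + 1) (h1 : 1 ≤ x i) (h2 : x i ≤ 2 * (n / 3)) :
    instance1 s(faceNode n x, faceNode n y) = rho n := by
  have key : ∀ {i j k : Fin 3} {x y : Fin 3 → ℕ}, Tri i j k → ∑ l, x l = n → ∑ l, y l = n →
      y i = x i → y j = x j + 1 → x k = y k + 1 → 1 ≤ x i → 2 * (n / 3) < y j →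
      instance1 s(faceNode n x, faceNode n y) = rho n := by
    intro i j k x y h hx hy hi hj hk h1 hlt
    rw [instance1_eq_cornerWeight_of_lt hn hn0 h hx hy hi hj hk hlt, cornerWeight,
      if_neg, if_neg]
    · intro hp
      have := hp _ (Sym2.mem_mk_left _ _) _ (Sym2.mem_mk_right _ _)
      rw [coord_faceNode hx, coord_faceNode hy, hj] at this
      have h0 : (0 : ℝ) < n := by exact_mod_cast hn0
      field_simp at this
      push_cast at this
      linarith
    · rw [mem_boundaryEdges hn0 hx hy ⟨i, j, k, h, hi, hj, hk⟩]
      rintro ⟨l, q1, q2⟩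
      rcases h.eq_or l with rfl | rfl | rfl <;> omega
  have hs : IsStep x y := ⟨i, j, k, h, hi, hj, hk⟩
  by_cases c1 : 2 * (n / 3) < y j
  · exact key h hx hy hi hj hk h1 c1
  by_cases c2 : 2 * (n / 3) < x k
  · rw [Sym2.eq_swap]
    exact key h.swap hy hx hi.symm hk hj (by omega) c2
  · unfold instance1
    rw [if_pos]
    refine mem_inducedEdges.2 ⟨adj_faceNode hn0 hx hy hs, (faceNode_mem_hexagon hn hn0 hx).2 ?_,
      (faceNode_mem_hexagon hn hn0 hy).2 ?_⟩ <;>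
    · intro l
      rcases h.eq_or l with rfl | rfl | rfl <;> omega

/-- The node `y` is the one closer to the corner `j`, so `stepsFrom` equals `y k = x k - 1`. -/
lemma instance1_of_side (hn : 3 ∣ n) (hn0 : 0 < n) (h : Tri i j k) {x y : Fin 3 → ℕ}
    (hx : ∑ l, x l = n) (hy : ∑ l, y l = n) (hi : y i = x i) (hj : y j = x j + 1)
    (hk : x k = y k + 1) (h1 : x i = 0) (hlt : 2 * (n / 3) < y j) :
    instance1 s(faceNode n x, faceNode n y) = rho n * (n / 3 - x k + 1 : ℕ) := by
  have hn1 : (0 : ℝ) < n := by exact_mod_cast hn0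
  rw [instance1_eq_cornerWeight_of_lt hn hn0 h hx hy hi hj hk hlt, cornerWeight, if_pos
    ((mem_boundaryEdges hn0 hx hy ⟨i, j, k, h, hi, hj, hk⟩).2 ⟨i, h1, by omega⟩), mul_comm]
  congr 1
  have e : ((s(faceNode n x, faceNode n y)).map fun x => coord x j.castSucc).sup = y j / n := by
    rw [Sym2.map_mk, Sym2.sup_mk, coord_faceNode hx, coord_faceNode hy]
    refine sup_eq_right.2 (div_le_div_of_nonneg_right ?_ hn1.le)
    exact_mod_cast (by omega : x j ≤ y j)
  rw [stepsFrom, e, mul_sub, mul_one, mul_div_cancel₀ _ hn1.ne']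
  rw [h.sum] at hx
  have e2 : n / 3 - x k + 1 + 2 * (n / 3) = y j := by omega
  have e3 : 3 * (n / 3) = n := by omega
  have e2' : ((n / 3 - x k + 1 : ℕ) : ℝ) + 2 * ((n / 3 : ℕ) : ℝ) = y j := by exact_mod_cast e2
  have e3' : 3 * ((n / 3 : ℕ) : ℝ) = n := by exact_mod_cast e3
  linarith

lemma rho_mul_cornerChanges_le (hn : 3 ∣ n) (hn0 : 0 < n) (i : Fin 3) :
    rho n * (cornerChanges n (linkedLabel P) (i + 1) i +
      cornerChanges n (linkedLabel P) (i + 2) i : ℕ) ≤ lineCost instance1 P i 0 := by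
  have h := Tri.succ i
  set f : ℕ → ℝ := fun u => instance1 (lineEdge n i 0 u) *
    differ (linkedLabel P (pt n i (i + 1) 0 u)) (linkedLabel P (pt n i (i + 1) 0 (u + 1))) with hf
  have hf0 : ∀ u, 0 ≤ f u := fun u => mul_nonneg (instance1_nonneg _) (Nat.cast_nonneg _)
  have step : ∀ u < n, ∑ l, pt n i (i + 1) 0 u l = n ∧ ∑ l, pt n i (i + 1) 0 (u + 1) l = n :=
    fun u hu => ⟨sum_pt h (by omega), sum_pt h (by omega)⟩
  have a1 : rho n * (cornerChanges n (linkedLabel P) (i + 1) i : ℕ) =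
      ∑ u ∈ Finset.range (n / 3), f u := by
    rw [cornerChanges, Nat.cast_sum, Finset.mul_sum]
    refine Finset.sum_congr rfl fun u hu => ?_
    have hu := Finset.mem_range.1 hu
    obtain ⟨s1, s2⟩ := step u (by omega)
    have w : instance1 (lineEdge n i 0 u) = rho n * (n / 3 - u : ℕ) := by
      rw [lineEdge, Sym2.eq_swap, instance1_of_side hn hn0 h.swap s2 s1 (by rw [pt_fst, pt_fst])
        (by rw [pt_thd h, pt_thd h]; omega) (by rw [pt_snd h, pt_snd h]) pt_fst
        (by rw [pt_thd h]; omega), pt_snd h]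
      congr 2; omega
    rw [hf]
    simp only
    rw [w, pt_comm h (by omega), pt_comm h (by omega)]
    push_cast
    ring
  have a2 : rho n * (cornerChanges n (linkedLabel P) (i + 2) i : ℕ) =
      ∑ u ∈ Finset.range (n / 3), f (n - 1 - u) := by
    rw [cornerChanges, Nat.cast_sum, Finset.mul_sum]
    refine Finset.sum_congr rfl fun u hu => ?_
    have hu := Finset.mem_range.1 hu
    obtain ⟨s1, s2⟩ := step (n - 1 - u) (by omega)
    have w : instance1 (lineEdge n i 0 (n - 1 - u)) = rho n * (n / 3 - u : ℕ) := by
      rw [lineEdge, instance1_of_side hn hn0 h s1 s2 (by rw [pt_fst, pt_fst])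
        (by rw [pt_snd h, pt_snd h]) (by rw [pt_thd h, pt_thd h]; omega) pt_fst
        (by rw [pt_snd h]; omega), pt_thd h]
      congr 2; omega
    have q1 : pt n (i + 2) i u 0 = pt n i (i + 1) 0 (n - 1 - u + 1) :=
      eq_pt h (sum_pt h.rot.rot (by omega)) (pt_snd h.rot.rot) (by rw [pt_thd h.rot.rot]; omega)
    have q2 : pt n (i + 2) i (u + 1) 0 = pt n i (i + 1) 0 (n - 1 - u) :=
      eq_pt h (sum_pt h.rot.rot (by omega)) (pt_snd h.rot.rot) (by rw [pt_thd h.rot.rot]; omega)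
    rw [hf]
    simp only
    rw [w, q1, q2, differ_comm]
    push_cast
    ring
  have a3 : ∑ u ∈ Finset.range (n / 3), f (n - 1 - u) = ∑ u ∈ Finset.Ico (2 * (n / 3)) n, f u := by
    refine Finset.sum_nbij' (fun u => n - 1 - u) (fun u => n - 1 - u) ?_ ?_ ?_ ?_ ?_ <;>
      · intro u hu
        simp only [Finset.mem_range, Finset.mem_Ico] at *
        try omega
  rw [Nat.cast_add, mul_add, a1, a2, a3, lineCost, ← Finset.sum_union]
  · refine Finset.sum_le_sum_of_subset_of_nonneg (fun u hu => ?_) fun u _ _ => hf0 u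
    simp only [Finset.mem_union, Finset.mem_range, Finset.mem_Ico] at *
    omega
  · rw [Finset.disjoint_left]
    intro u hu hu'
    simp only [Finset.mem_range, Finset.mem_Ico] at *
    omega

theorem rho_mul_totalChanges_le_cost (hn : 3 ∣ n) (hn0 : 0 < n) :
    rho n * totalChanges n (linkedLabel P) ≤ cost instance1 P := by
  refine le_trans ?_ (sum_lineCost_le_cost instance1_nonneg P)
  -- `totalChanges` groups the corner terms by the first index of `cornerChanges`. Here they are
  -- regrouped by the side `x i = 0` on which they lie, so that each belongs to the line of level 0.
  have e : totalChanges n (linkedLabel P) =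
      ∑ i, (∑ t ∈ Finset.Icc 1 (2 * (n / 3)), lineChanges n (linkedLabel P) i t +
        (cornerChanges n (linkedLabel P) (i + 1) i + cornerChanges n (linkedLabel P) (i + 2) i)) := by
    simp only [totalChanges, Finset.sum_add_distrib]
    congr 1
    simp only [Fin.sum_univ_three, zero_add, show (1 + 1 : Fin 3) = 2 from rfl,
      show (1 + 2 : Fin 3) = 0 from rfl, show (2 + 1 : Fin 3) = 0 from rfl,
      show (2 + 2 : Fin 3) = 1 from rfl]
    ring
  rw [e, Nat.cast_sum, Finset.mul_sum]
  refine Finset.sum_le_sum fun i _ => ?_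
  have h := Tri.succ i
  have hsub : insert 0 (Finset.Icc 1 (2 * (n / 3))) ⊆ Finset.range n := by
    intro t ht
    simp only [Finset.mem_insert, Finset.mem_Icc, Finset.mem_range] at *
    omega
  refine le_trans ?_ (Finset.sum_le_sum_of_subset_of_nonneg hsub fun t _ _ =>
    lineCost_nonneg instance1_nonneg i t)
  rw [Finset.sum_insert (by simp), Nat.cast_add, mul_add, add_comm]
  refine add_le_add (rho_mul_cornerChanges_le hn hn0 i) ?_
  rw [Nat.cast_sum, Finset.mul_sum]
  refine Finset.sum_le_sum fun t ht => lineCost_ge fun u hu => ?_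
  have ht := Finset.mem_Icc.1 ht
  rw [lineEdge, instance1_of_interior hn hn0 h (sum_pt h (by omega)) (sum_pt h (by omega))
    (by rw [pt_fst, pt_fst]) (by rw [pt_snd h, pt_snd h]) (by rw [pt_thd h, pt_thd h]; omega)
    (by rw [pt_fst]; omega) (by rw [pt_fst]; omega)]

/-! ### The second instance -/

lemma instance2_nonneg (e : Sym2 (Node n)) : 0 ≤ instance2 e := by
  unfold instance2; split_ifs <;> norm_num

theorem sum_lineChanges_le_cost (hn0 : 0 < n) :
    1 / 3 * (∑ i, lineChanges n (linkedLabel P) i 0 : ℕ) ≤ cost instance2 P := by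
  refine le_trans ?_ (sum_lineCost_le_cost instance2_nonneg P)
  rw [Nat.cast_sum, Finset.mul_sum]
  refine Finset.sum_le_sum fun i _ => ?_
  have h := Tri.succ i
  refine le_trans ?_ (Finset.single_le_sum (fun t _ => lineCost_nonneg instance2_nonneg i t)
    (Finset.mem_range.2 hn0))
  refine lineCost_ge fun u hu => ?_
  rw [instance2, if_pos]
  exact (mem_boundaryEdges hn0 (sum_pt h (by omega)) (sum_pt h (by omega)) (isStep_pt h hu)).2
    ⟨i, pt_fst, pt_fst⟩

end MultiwayCut

end

noncomputable section

open scoped Classical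

namespace MultiwayCut

variable {n : ℕ} {i j k : Fin 3} {P : Node n → Fin 5}

/-! ### The third instance -/

lemma instance3_nonneg {c : ℝ} (hc : 0 < c) (e : Sym2 (Node n)) : 0 ≤ instance3 c e := by
  unfold instance3; split_ifs <;> positivity

lemma faceNode_mem_redNodes (hn0 : 0 < n) {c : ℝ} {m : ℕ} (hm : c * n = m) (hmn : m ≤ n)
    {x : Fin 3 → ℕ} (hx : ∑ l, x l = n)
    (h : x k = n - m ∨ n - m ≤ x k ∧ ∃ l, l ≠ k ∧ x l = 0) :
    faceNode n x ∈ redNodes n c k.castSucc := by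
  have hn1 : (0 : ℝ) < n := by exact_mod_cast hn0
  have e : 1 - c = ((n - m : ℕ) : ℝ) / n := by
    rw [eq_div_iff hn1.ne', Nat.cast_sub hmn]
    linarith
  rcases h with h | ⟨h1, l, hlk, hl⟩
  · left
    refine ⟨faceNode_mem_face hx, ?_⟩
    rw [coord_faceNode hx, h, e]
  · right
    obtain ⟨j, hj⟩ := Tri.exists_third hlk
    refine ⟨⟨j.castSucc, ?_, ?_, (faceNode_mem_sideNodes hn0 hj.rot.rot.swap hx).2 ?_⟩,
      ?_⟩
    · exact ne_three_iff.2 ⟨j, rfl⟩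
    · exact fun h => hj.jk (Fin.castSucc_injective _ h).symm
    · exact hl
    · rw [coord_faceNode hx, e]
      exact div_le_div_of_nonneg_right (by exact_mod_cast h1) hn1.le

lemma instance3_eq (hn0 : 0 < n) {c : ℝ} {m : ℕ} (hm : c * n = m) (hmn : m ≤ n)
    {x y : Fin 3 → ℕ} (hx : ∑ l, x l = n) (hy : ∑ l, y l = n) (hs : IsStep x y)
    (h : x k = n - m ∨ n - m ≤ x k ∧ ∃ l, l ≠ k ∧ x l = 0)
    (h' : y k = n - m ∨ n - m ≤ y k ∧ ∃ l, l ≠ k ∧ y l = 0) :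
    instance3 c s(faceNode n x, faceNode n y) = 1 / (9 * c) := by
  rw [instance3, if_pos]
  exact ⟨k.castSucc, ne_three_iff.2 ⟨k, rfl⟩, mem_inducedEdges.2 ⟨adj_faceNode hn0 hx hy hs,
    faceNode_mem_redNodes hn0 hm hmn hx h, faceNode_mem_redNodes hn0 hm hmn hy h'⟩⟩

/-- The label changes on the part `x k ≥ n - m` of the side `x i = 0`. -/
def endChanges (n : ℕ) (lab : (Fin 3 → ℕ) → Option (Fin 3)) (i k : Fin 3) (m : ℕ) : ℕ :=
  changes (fun u => lab (pt n i k 0 u)) (n - m) n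

lemma endChanges_add_le (hn0 : 0 < n) {c : ℝ} (hc : 0 < c) {m : ℕ} (hm : c * n = m)
    (hmn : 2 * m < n) (i : Fin 3) :
    1 / (9 * c) * (endChanges n (linkedLabel P) i (i + 1) m +
      endChanges n (linkedLabel P) i (i + 2) m : ℕ) ≤ lineCost (instance3 c) P i 0 := by
  have h := Tri.succ i
  set d : ℕ → ℕ := fun u => differ (linkedLabel P (pt n i (i + 1) 0 u))
    (linkedLabel P (pt n i (i + 1) 0 (u + 1))) with hd
  have e1 : endChanges n (linkedLabel P) i (i + 1) m = ∑ u ∈ Finset.Ico (n - m) n, d u := by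
    rw [endChanges, changes_eq_sum]
  have e2 : endChanges n (linkedLabel P) i (i + 2) m = ∑ u ∈ Finset.range m, d u := by
    rw [endChanges, changes_eq_sum]
    refine Finset.sum_nbij' (fun u => n - 1 - u) (fun u => n - 1 - u) ?_ ?_ ?_ ?_ ?_
    · intro u hu
      simp only [Finset.mem_range, Finset.mem_Ico] at *
      omega
    · intro u hu
      simp only [Finset.mem_range, Finset.mem_Ico] at *
      omega
    · intro u hu
      rw [Finset.mem_Ico] at hu
      omega
    · intro u hu
      rw [Finset.mem_range] at hu
      omega
    · intro u hu
      have hu := Finset.mem_Ico.1 hu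
      rw [differ_comm, pt_swap h.swap (by omega), pt_swap h.swap (by omega), hd]
      simp only
      congr 3 <;> omega
  rw [e1, e2, ← Finset.sum_union, Nat.cast_sum, Finset.mul_sum]
  · refine le_trans (Finset.sum_le_sum fun u hu => ?_)
      (Finset.sum_le_sum_of_subset_of_nonneg (t := Finset.range (n - 0)) (f := fun u =>
        instance3 c (lineEdge n i 0 u) * (d u : ℝ)) (fun u hu => ?_) fun u _ _ =>
          mul_nonneg (instance3_nonneg hc _) (Nat.cast_nonneg _))
    · refine mul_le_mul_of_nonneg_right ?_ (Nat.cast_nonneg _)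
      rw [Finset.mem_union, Finset.mem_Ico, Finset.mem_range] at hu
      have hun : 0 + u < n := by omega
      rw [lineEdge]
      rcases hu with hu | hu
      · exact (instance3_eq (k := i + 1) hn0 hm (by omega) (sum_pt h (by omega))
          (sum_pt h (by omega)) (isStep_pt h hun)
          (Or.inr ⟨by rw [pt_snd h]; omega, i, h.ij, pt_fst⟩)
          (Or.inr ⟨by rw [pt_snd h]; omega, i, h.ij, pt_fst⟩)).ge
      · exact (instance3_eq (k := i + 2) hn0 hm (by omega) (sum_pt h (by omega))
          (sum_pt h (by omega)) (isStep_pt h hun)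
          (Or.inr ⟨by rw [pt_thd h]; omega, i, h.ik, pt_fst⟩)
          (Or.inr ⟨by rw [pt_thd h]; omega, i, h.ik, pt_fst⟩)).ge
    · simp only [Finset.mem_union, Finset.mem_range, Finset.mem_Ico] at *
      omega
  · rw [Finset.disjoint_left]
    intro u hu hu'
    simp only [Finset.mem_range, Finset.mem_Ico] at *
    omega

variable {lab : (Fin 3 → ℕ) → Option (Fin 3)}

lemma differ_add_ge {α : Type*} {a b : α} (h : a ≠ b) (e : α) : 1 ≤ differ a e + differ e b := by
  by_cases h1 : a = e
  · subst h1
    rw [differ_of_ne h]; omega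
  · rw [differ_of_ne h1]; omega

/-- The boundary of a corner that is not sealed has two label changes. -/
lemma two_le_of_not_isSealed (hlab : lab (Pi.single k n) = some k) (h : Tri i j k) {m : ℕ}
    (hmn : m ≤ n) (hk : ¬ IsSealed n lab m k) :
    2 ≤ lineChanges n lab k (n - m) + (endChanges n lab i k m + endChanges n lab j k m) := by
  -- The line `x k = n - m` and the two side pieces form a closed cycle through the corner, which is
  -- labeled `k`. A point with another label splits the cycle into two arcs to the corner, and each
  -- arc contains a change.
  have side : ∀ {i j k : Fin 3}, Tri i j k → lab (Pi.single k n) = some k → ∀ v, n - m ≤ v →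
      v ≤ n → differ (lab (pt n k i (n - m) 0)) (lab (pt n i k 0 v)) +
        differ (lab (pt n i k 0 v)) (some k) ≤ endChanges n lab i k m := by
    intro i j k h hlab v h1 h2
    have e1 := differ_le_changes (fun u => lab (pt n i k 0 u)) h1
    have e2 := differ_le_changes (fun u => lab (pt n i k 0 u)) h2
    have e3 := changes_add (fun u => lab (pt n i k 0 u)) h1 h2
    have e4 : pt n i k 0 n = Pi.single k n := by
      rw [← pt_zero_zero h.rot.rot, pt_swap h.swap (by omega)]
      congr 1; omega
    rw [e4, hlab] at e2
    rw [pt_comm h.rot.rot (by omega), endChanges]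
    omega
  have line : ∀ x : Fin 3 → ℕ, ∑ l, x l = n → x k = n - m →
      differ (lab (pt n k i (n - m) 0)) (lab x) + differ (lab x) (lab (pt n k j (n - m) 0)) ≤
        lineChanges n lab k (n - m) := fun x hx hxk =>
    differ_add_differ_le_lineChanges h.rot.rot hx hxk
  have s1 := side h hlab
  have s2 := side h.swap.rot.rot hlab
  have ends : ∀ {i k : Fin 3} (l : Fin 3) , Tri i l k → pt n k i (n - m) 0 = pt n i k 0 (n - m) :=
    fun l h => pt_comm h.rot.rot (by omega)
  unfold IsSealed at hk
  push Not at hk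
  obtain ⟨x, hx, hx1, hx2⟩ := hk
  have t1 := s1 (n - m) le_rfl (by omega)
  have t2 := s2 (n - m) le_rfl (by omega)
  rw [← ends j h, differ_self, zero_add] at t1
  rw [← ends i h.swap.rot.rot, differ_self, zero_add] at t2
  rcases hx1 with hxk | ⟨hxk, l, hlk, hxl⟩
  · have l1 := line x hx hxk
    have g1 := differ_add_ge hx2 (lab (pt n k i (n - m) 0))
    have g2 := differ_add_ge hx2 (lab (pt n k j (n - m) 0))
    rw [differ_comm (lab x)] at g1
    omega
  · have l1 := line _ (sum_pt h.rot.rot (t := n - m) (u := 0) (by omega)) pt_fst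
    rw [differ_self, zero_add] at l1
    have hx' := hx
    rw [h.sum] at hx'
    rcases h.eq_or l with rfl | rfl | rfl
    · have s1 := s1 (x k) hxk (by omega)
      rw [← eq_pt h.swap hx hxl rfl, differ_of_ne hx2] at s1
      have g1 := differ_add_ge hx2 (lab (pt n k l (n - m) 0))
      have g2 := differ_add_ge (b := some k) (a := lab (pt n k l (n - m) 0))
      rw [differ_comm (lab x)] at g1
      by_cases q : lab (pt n k l (n - m) 0) = some k
      · rw [q, differ_comm, differ_of_ne hx2] at s1
        omega
      · have := g2 q (lab (pt n k j (n - m) 0))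
        omega
    · have s2 := s2 (x k) hxk (by omega)
      rw [← eq_pt h.rot hx hxl rfl, differ_of_ne hx2] at s2
      by_cases q : lab (pt n k l (n - m) 0) = some k
      · rw [q, differ_comm, differ_of_ne hx2] at s2
        omega
      · have := differ_add_ge q (lab (pt n k i (n - m) 0))
        rw [differ_comm (lab (pt n k l (n - m) 0))] at this
        omega
    · exact absurd rfl hlk

theorem card_not_isSealed_le_cost (hn0 : 0 < n) (hP : IsCut P) {c : ℝ} (hc : 0 < c) {m : ℕ}
    (hm : c * n = m) (hmn : 2 * m < n) :
    2 / (9 * c) * ((Finset.univ.filter fun k => ¬ IsSealed n (linkedLabel P) m k).card : ℕ) ≤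
      cost (instance3 c) P := by
  have hn1 : (0 : ℝ) < n := by exact_mod_cast hn0
  have hm0 : 0 < m := by
    have : (0 : ℝ) < m := hm ▸ mul_pos hc hn1
    exact_mod_cast this
  refine le_trans ?_ (sum_lineCost_le_cost (instance3_nonneg hc) P)
  set lab := linkedLabel P with hlab
  have e1 : 2 * (Finset.univ.filter fun k => ¬ IsSealed n lab m k).card ≤
      ∑ i, (endChanges n lab i (i + 1) m + endChanges n lab i (i + 2) m +
        lineChanges n lab i (n - m)) := by
    have e2 : ∑ i, (endChanges n lab i (i + 1) m + endChanges n lab i (i + 2) m +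
        lineChanges n lab i (n - m)) = ∑ k, (lineChanges n lab k (n - m) +
          (endChanges n lab (k + 1) k m + endChanges n lab (k + 2) k m)) := by
      simp only [Fin.sum_univ_three, zero_add, show (1 + 1 : Fin 3) = 2 from rfl,
        show (1 + 2 : Fin 3) = 0 from rfl, show (2 + 1 : Fin 3) = 0 from rfl,
        show (2 + 2 : Fin 3) = 1 from rfl]
      ring
    rw [e2, Finset.card_filter, Finset.mul_sum]
    refine Finset.sum_le_sum fun k _ => ?_
    by_cases hk : IsSealed n lab m k
    · simp [hk]
    · rw [if_pos hk]
      exact two_le_of_not_isSealed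
        (show linkedLabel P (Pi.single k n) = some k from
          (show IsLinked P k _ from Relation.ReflTransGen.refl).linkedLabel_eq hP)
        (Tri.succ k).rot (by omega) hk
  have e1' : 2 * ((Finset.univ.filter fun k => ¬ IsSealed n lab m k).card : ℝ) ≤
      ((∑ i, (endChanges n lab i (i + 1) m + endChanges n lab i (i + 2) m +
        lineChanges n lab i (n - m)) : ℕ) : ℝ) := by exact_mod_cast e1
  have hr : (0 : ℝ) ≤ 1 / (9 * c) := by positivity
  calc 2 / (9 * c) * ((Finset.univ.filter fun k => ¬ IsSealed n lab m k).card : ℕ)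
      = 1 / (9 * c) * (2 * ((Finset.univ.filter fun k => ¬ IsSealed n lab m k).card : ℝ)) := by
        ring
    _ ≤ _ := mul_le_mul_of_nonneg_left e1' hr
    _ ≤ _ := by
      rw [Nat.cast_sum, Finset.mul_sum]
      refine Finset.sum_le_sum fun i _ => ?_
      have hsub : ({0, n - m} : Finset ℕ) ⊆ Finset.range n := by
        intro t ht
        simp only [Finset.mem_insert, Finset.mem_singleton, Finset.mem_range] at *
        omega
      refine le_trans ?_ (Finset.sum_le_sum_of_subset_of_nonneg hsub fun t _ _ =>
        lineCost_nonneg (instance3_nonneg hc) i t)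
      rw [Finset.sum_insert (by rw [Finset.mem_singleton]; omega), Finset.sum_singleton,
        Nat.cast_add, mul_add]
      refine add_le_add (endChanges_add_le hn0 hc hm hmn i) (lineCost_ge fun u hu => ?_)
      have h := Tri.succ i
      rw [lineEdge, instance3_eq (k := i) hn0 hm (by omega) (sum_pt h (by omega))
        (sum_pt h (by omega)) (isStep_pt h hu) (Or.inl pt_fst) (Or.inl pt_fst)]

end MultiwayCut

end

noncomputable section

open scoped Classical

namespace MultiwayCut

variable {n : ℕ} {P : Node n → Fin 5}

/-! ### The fourth instance -/

lemma instance4_nonneg (e : Sym2 (Node n)) : 0 ≤ instance4 e := by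
  unfold instance4; split_ifs <;> positivity

/-- The points `z` that index the cells `{z + e_i}` of the tetrahedron of size `n`. -/
def cells (n : ℕ) : Finset (Fin 4 → ℕ) :=
  (Finset.piAntidiag Finset.univ (n - 1)).filter fun _ => 0 < n

lemma mem_cells {z : Fin 4 → ℕ} : z ∈ cells n ↔ ∑ l, z l + 1 = n := by
  rw [cells, Finset.mem_filter, Finset.mem_piAntidiag]
  constructor
  · rintro ⟨⟨h1, -⟩, h2⟩
    have h1 : ∑ l, z l = n - 1 := h1
    omega
  · intro h
    have h1 : ∑ l, z l = n - 1 := by omega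
    exact ⟨⟨h1, fun l _ => Finset.mem_univ l⟩, by omega⟩

lemma sum_add_single (z : Fin 4 → ℕ) (i : Fin 4) :
    ∑ l, (z + Pi.single i 1 : Fin 4 → ℕ) l = ∑ l, z l + 1 := by
  simp [Finset.sum_add_distrib]

/-- The node `z + e_i` of a cell. -/
def cellNode (n : ℕ) (z : Fin 4 → ℕ) (i : Fin 4) : Node n :=
  if h : ∑ l, z l + 1 = n then Node.ofSum (z + Pi.single i 1) ((sum_add_single z i).trans h)
  else terminal n 0

lemma cellNode_val {z : Fin 4 → ℕ} (hz : z ∈ cells n) (i : Fin 4) :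
    (cellNode n z i).1 = z + Pi.single i 1 := by
  rw [cellNode, dif_pos (mem_cells.1 hz)]; rfl

lemma cellNode_eq_iff {z w : Fin 4 → ℕ} (hz : z ∈ cells n) (hw : w ∈ cells n) {i j : Fin 4} :
    cellNode n z i = cellNode n w j ↔
      z + Pi.single i 1 = (w + Pi.single j 1 : Fin 4 → ℕ) := by
  rw [← cellNode_val hz, ← cellNode_val hw]
  exact Subtype.ext_iff

lemma adj_cellNode {z : Fin 4 → ℕ} (hz : z ∈ cells n) {i j : Fin 4} (hij : i ≠ j) :
    (graph n).Adj (cellNode n z i) (cellNode n z j) := by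
  have hn : (0 : ℝ) < n := by
    have := mem_cells.1 hz
    exact_mod_cast (by omega : 0 < n)
  refine ⟨fun h => ?_, ?_⟩
  · have := congrFun ((cellNode_eq_iff hz hz).1 h) i
    simp [hij] at this
  · have key : ∀ l, |coord (cellNode n z i) l - coord (cellNode n z j) l| =
        (if l = i then 1 / (n : ℝ) else 0) + if l = j then 1 / (n : ℝ) else 0 := by
      intro l
      rw [coord, coord, cellNode_val hz, cellNode_val hz, Pi.add_apply, Pi.add_apply]
      by_cases h1 : l = i
      · subst h1
        rw [Pi.single_eq_same, Pi.single_eq_of_ne hij, if_pos rfl, if_neg hij]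
        push_cast
        rw [add_zero, add_zero, add_div, add_sub_cancel_left, abs_of_pos (by positivity)]
      · by_cases h2 : l = j
        · subst h2
          rw [Pi.single_eq_same, Pi.single_eq_of_ne h1, if_pos rfl, if_neg h1]
          push_cast
          rw [add_zero, zero_add, add_div, sub_add_cancel_left, abs_neg,
            abs_of_pos (by positivity)]
        · rw [Pi.single_eq_of_ne h1, Pi.single_eq_of_ne h2, if_neg h1, if_neg h2]
          simp
    rw [Finset.sum_congr rfl fun l _ => key l, Finset.sum_add_distrib, Finset.sum_ite_eq',
      Finset.sum_ite_eq', if_pos (Finset.mem_univ _), if_pos (Finset.mem_univ _)]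
    ring

/-- The cells with two different labels. -/
def mixedCells (P : Node n → Fin 5) : Finset (Fin 4 → ℕ) :=
  (cells n).filter fun z => ∃ i j, P (cellNode n z i) ≠ P (cellNode n z j)

/-- A cut of the complete graph on four vertices has at least three edges, attained by isolating one
vertex. -/
lemma three_le_card_pairs {α : Type*} (f : Fin 4 → α) (h : ∃ i j, f i ≠ f j) :
    3 ≤ ((Finset.univ : Finset (Fin 4 × Fin 4)).filter
      fun p => p.1 < p.2 ∧ f p.1 ≠ f p.2).card := by
  have e : ((Finset.univ : Finset (Fin 4 × Fin 4)).filter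
      fun p => p.1 < p.2 ∧ f p.1 ≠ f p.2).card = differ (f 0) (f 1) + differ (f 0) (f 2) +
        differ (f 0) (f 3) + differ (f 1) (f 2) + differ (f 1) (f 3) + differ (f 2) (f 3) := by
    rw [Finset.card_filter, Fintype.sum_prod_type]
    simp only [Fin.sum_univ_four, differ]
    simp
    ring
  have h' : ¬ (f 0 = f 1 ∧ f 0 = f 2 ∧ f 0 = f 3) := by
    rintro ⟨h1, h2, h3⟩
    obtain ⟨i, j, hij⟩ := h
    have : ∀ l, f l = f 0 := by
      intro l
      fin_cases l
      · rfl
      · exact h1.symm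
      · exact h2.symm
      · exact h3.symm
    exact hij ((this i).trans (this j).symm)
  rw [e]
  unfold differ
  grind

/-- Each cell with two different labels has three edges in the cut-set. -/
lemma card_mixedCells_le_cost (P : Node n → Fin 5) :
    3 * ((mixedCells P).card : ℝ) / n ^ 2 ≤ cost instance4 P := by
  set J := (mixedCells P).sigma fun z => (Finset.univ : Finset (Fin 4 × Fin 4)).filter
    fun p => p.1 < p.2 ∧ P (cellNode n z p.1) ≠ P (cellNode n z p.2) with hJ
  have hJc : 3 * (mixedCells P).card ≤ J.card := by
    rw [hJ, Finset.card_sigma, mul_comm, ← smul_eq_mul, ← Finset.sum_const]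
    refine Finset.sum_le_sum fun z hz => ?_
    exact (three_le_card_pairs (fun i => P (cellNode n z i))
      (Finset.mem_filter.1 hz).2).trans_eq (by congr)
  have hmem : ∀ q ∈ J, q.1 ∈ cells n ∧ q.2.1 < q.2.2 ∧
      P (cellNode n q.1 q.2.1) ≠ P (cellNode n q.1 q.2.2) := by
    intro q hq
    obtain ⟨h1, h2⟩ := Finset.mem_sigma.1 hq
    exact ⟨(Finset.mem_filter.1 h1).1, (Finset.mem_filter.1 h2).2⟩
  set g : (Σ _ : Fin 4 → ℕ, Fin 4 × Fin 4) → Sym2 (Node n) := fun q =>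
    s(cellNode n q.1 q.2.1, cellNode n q.1 q.2.2) with hg
  have hinj : Set.InjOn g J := by
    rintro ⟨z, i, j⟩ hq ⟨w, i', j'⟩ hq' e
    obtain ⟨z1, z2, -⟩ := hmem _ hq
    obtain ⟨w1, w2, -⟩ := hmem _ hq'
    simp only at z1 z2 w1 w2
    -- All cells are translates of one tetrahedron, so an edge determines its cell and no cut edge
    -- is counted for two cells.
    have sing : ∀ a b c d : Fin 4, a ≠ b → z + Pi.single a 1 = (w + Pi.single c 1 : Fin 4 → ℕ) →
        z + Pi.single b 1 = (w + Pi.single d 1 : Fin 4 → ℕ) → a = c ∧ b = d := by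
      intro a b c d hab e1 e2
      have p1 := congrFun e1 a
      have p2 := congrFun e2 a
      have p3 := congrFun e1 b
      have p4 := congrFun e2 b
      simp only [Pi.add_apply, Pi.single_apply, if_true, hab, hab.symm, if_false] at p1 p2 p3 p4
      constructor
      · by_contra hc
        rw [if_neg hc] at p1
        omega
      · by_contra hd
        rw [if_neg hd] at p4
        omega
    rcases Sym2.eq_iff.1 e with ⟨e1, e2⟩ | ⟨e1, e2⟩
    · have e1 := (cellNode_eq_iff z1 w1).1 e1
      have e2 := (cellNode_eq_iff z1 w1).1 e2
      obtain ⟨rfl, rfl⟩ := sing _ _ _ _ z2.ne e1 e2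
      rw [add_right_cancel e1]
    · have e1 := (cellNode_eq_iff z1 w1).1 e1
      have e2 := (cellNode_eq_iff z1 w1).1 e2
      obtain ⟨rfl, rfl⟩ := sing _ _ _ _ z2.ne e1 e2
      exact absurd z2 w2.asymm
  have hcost : ∑ q ∈ J, instance4 (g q) ≤ cost instance4 P := by
    rw [cost, ← Finset.sum_image hinj]
    refine Finset.sum_le_sum_of_subset_of_nonneg (fun e he => ?_) fun e _ _ => instance4_nonneg e
    obtain ⟨q, hq, rfl⟩ := Finset.mem_image.1 he
    obtain ⟨h1, h2, h3⟩ := hmem q hq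
    exact Finset.mem_filter.2 ⟨Finset.mem_univ _, _, _, rfl, adj_cellNode h1 h2.ne, h3⟩
  have hval : ∀ q ∈ J, instance4 (g q) = 1 / (n : ℝ) ^ 2 := by
    intro q hq
    obtain ⟨h1, h2, -⟩ := hmem q hq
    rw [instance4, if_pos]
    exact (SimpleGraph.mem_edgeSet _).2 (adj_cellNode h1 h2.ne)
  rw [Finset.sum_congr rfl hval, Finset.sum_const, nsmul_eq_mul] at hcost
  refine le_trans ?_ hcost
  rw [mul_one_div]
  refine div_le_div_of_nonneg_right ?_ (by positivity)
  exact_mod_cast hJc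

/-- The corner that receives a color; the additional color is treated like the last corner. -/
def colorIndex (c : Fin 5) : Fin 4 := if h : c = Fin.last 4 then 3 else c.castPred h

lemma colorIndex_castSucc (i : Fin 4) : colorIndex i.castSucc = i := by
  rw [colorIndex, dif_neg (Fin.castSucc_lt_last i).ne, Fin.castPred_castSucc]

/-- In a cell of a single color, the coordinate of that color is positive. -/
lemma colorIndex_pos (hO : IsNonOpposite P) {z : Fin 4 → ℕ} (hz : z ∈ cells n)
    (hm : ∀ i, P (cellNode n z i) = P (cellNode n z 0))
    (hb : ¬ (P (cellNode n z 0) = Fin.last 4 ∧ z 3 = 0)) :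
    1 ≤ z (colorIndex (P (cellNode n z 0))) := by
  by_cases hl : P (cellNode n z 0) = Fin.last 4
  · rw [hl, colorIndex, dif_pos rfl]
    have : z 3 ≠ 0 := fun h => hb ⟨hl, h⟩
    omega
  · obtain ⟨c, hc⟩ := Fin.exists_castSucc_eq.2 hl
    rw [← hc, colorIndex_castSucc]
    obtain ⟨j, hj⟩ : ∃ j : Fin 4, j ≠ c := by clear hc; revert c; decide
    rcases hO (cellNode n z j) with ⟨i, hi, hi2⟩ | h2
    · rw [hm j, ← hc] at hi2
      rw [← Fin.castSucc_injective _ hi2, support, Set.mem_ofPred_eq, Ne,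
        coord_eq_zero (by have := mem_cells.1 hz; omega), cellNode_val hz, Pi.add_apply,
        Pi.single_eq_of_ne hj.symm] at hi
      omega
    · exact absurd ((hm j).symm.trans h2) hl

/-- The cells on the face are dominated by the cells with two different labels and the points
without a corner label. -/
lemma card_points_le (hO : IsNonOpposite P) (hn : 0 < n) :
    (points (n - 1)).card ≤ (mixedCells P).card + (unlabeled n (linkedLabel P)).card := by
  set base := (cells n).filter fun z => z 3 = 0
  set mono := (cells n).filter fun z => ¬ ∃ i j, P (cellNode n z i) ≠ P (cellNode n z j)
  set bad := mono.filter fun z => P (cellNode n z 0) = Fin.last 4 ∧ z 3 = 0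
  set good := mono.filter fun z => ¬ (P (cellNode n z 0) = Fin.last 4 ∧ z 3 = 0)
  have e1 : (mixedCells P).card + mono.card = (cells n).card :=
    Finset.card_filter_add_card_filter_not _
  have e2 : bad.card + good.card = mono.card := Finset.card_filter_add_card_filter_not _
  have e3 : base.card + ((cells n).filter fun z => ¬ z 3 = 0).card = (cells n).card :=
    Finset.card_filter_add_card_filter_not _
  have hmono : ∀ z ∈ mono, z ∈ cells n ∧ ∀ i, P (cellNode n z i) = P (cellNode n z 0) := by
    intro z hz
    obtain ⟨h1, h2⟩ := Finset.mem_filter.1 hz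
    push Not at h2
    exact ⟨h1, fun i => h2 i 0⟩
  have h1 : (points (n - 1)).card ≤ base.card := by
    refine Finset.card_le_card_of_injOn (fun x => Fin.snoc (α := fun _ => ℕ) x 0)
      (fun x hx => ?_) ?_
    · have hx := mem_points.1 hx
      refine Finset.mem_coe.2 (Finset.mem_filter.2 ⟨mem_cells.2 ?_, ?_⟩)
      · rw [Fin.sum_univ_castSucc]
        simp only [Fin.snoc_castSucc, Fin.snoc_last]
        omega
      · exact Fin.snoc_last (n := 3) (α := fun _ => ℕ) 0 x
    · intro x _ y _ e
      funext l
      have := congrFun e l.castSucc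
      simpa only [Fin.snoc_castSucc] using this
  -- Shift a one-colored cell from its color's corner towards the last corner. If two cells have the
  -- same image, then `z + e_(idx w) = w + e_(idx z)` is a node of both cells. Their colors thus
  -- agree, and so do the cells.
  have h2 : good.card ≤ ((cells n).filter fun z => ¬ z 3 = 0).card := by
    set idx : (Fin 4 → ℕ) → Fin 4 := fun z => colorIndex (P (cellNode n z 0)) with hidx
    have hgood : ∀ z ∈ good, z ∈ cells n ∧ (∀ i, P (cellNode n z i) = P (cellNode n z 0)) ∧
        ∀ l, (Pi.single (idx z) 1 : Fin 4 → ℕ) l ≤ z l := by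
      intro z hz
      obtain ⟨q1, q2⟩ := Finset.mem_filter.1 hz
      obtain ⟨q3, q4⟩ := hmono z q1
      refine ⟨q3, q4, fun l => ?_⟩
      have := colorIndex_pos hO q3 q4 q2
      rw [Pi.single_apply]
      split_ifs with h
      · rw [h]; exact this
      · exact Nat.zero_le _
    refine Finset.card_le_card_of_injOn
      (fun z l => z l - (Pi.single (idx z) 1 : Fin 4 → ℕ) l + (Pi.single 3 1 : Fin 4 → ℕ) l)
      (fun z hz => ?_) ?_
    · obtain ⟨q1, -, q3⟩ := hgood z hz
      refine Finset.mem_coe.2 (Finset.mem_filter.2 ⟨mem_cells.2 ?_, ?_⟩)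
      · have q4 := mem_cells.1 q1
        have s1 : ∑ l, (z l - (Pi.single (idx z) 1 : Fin 4 → ℕ) l) + 1 = ∑ l, z l := by
          have : ∑ l, (z l - (Pi.single (idx z) 1 : Fin 4 → ℕ) l) +
              ∑ l, (Pi.single (idx z) 1 : Fin 4 → ℕ) l = ∑ l, z l := by
            rw [← Finset.sum_add_distrib]
            exact Finset.sum_congr rfl fun l _ => Nat.sub_add_cancel (q3 l)
          rwa [Finset.sum_pi_single', if_pos (Finset.mem_univ _)] at this
        rw [Finset.sum_add_distrib, Finset.sum_pi_single', if_pos (Finset.mem_univ _)]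
        omega
      · simp
    · intro z hz w hw e
      obtain ⟨z1, z2, z3⟩ := hgood z hz
      obtain ⟨w1, w2, w3⟩ := hgood w hw
      have key : z + Pi.single (idx w) 1 = (w + Pi.single (idx z) 1 : Fin 4 → ℕ) := by
        funext l
        have q1 := congrFun e l
        have q2 := z3 l
        have q3 := w3 l
        simp only [Pi.add_apply] at *
        omega
      have hc := congrArg P ((cellNode_eq_iff z1 w1).2 key)
      rw [z2, w2] at hc
      have : idx z = idx w := by rw [hidx]; simp only; rw [hc]
      rw [this] at key
      exact add_right_cancel key
  -- The shift is impossible for a cell of the extra color with `z 3 = 0`. Its node `z + e_0` lies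
  -- on the face and is unlabeled, and different cells give different nodes.
  have h3 : bad.card ≤ (unlabeled n (linkedLabel P)).card := by
    have hbad : ∀ z ∈ bad, z ∈ cells n ∧ P (cellNode n z 0) = Fin.last 4 ∧ z 3 = 0 := by
      intro z hz
      obtain ⟨q1, q2⟩ := Finset.mem_filter.1 hz
      exact ⟨(hmono z q1).1, q2⟩
    refine Finset.card_le_card_of_injOn (fun z l => (cellNode n z 0).1 l.castSucc)
      (fun z hz => ?_) ?_
    · obtain ⟨q1, q2, q3⟩ := hbad z hz
      have s3 : (cellNode n z 0).1 3 = 0 := by rw [cellNode_val q1]; simpa using q3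
      have s4 : ∑ l : Fin 3, (cellNode n z 0).1 l.castSucc = n := by
        have s5 := (cellNode n z 0).2
        rw [Fin.sum_univ_castSucc, show Fin.last 3 = (3 : Fin 4) from rfl, s3, add_zero] at s5
        exact s5
      have s6 : faceNode n (fun l => (cellNode n z 0).1 l.castSucc) = cellNode n z 0 := by
        apply Subtype.ext
        funext m
        by_cases hm : m = 3
        · rw [hm, faceNode_three s4, s3]
        · obtain ⟨l, rfl⟩ := ne_three_iff.1 hm
          rw [faceNode_castSucc s4]
      refine Finset.mem_coe.2 (mem_unlabeled.2 ⟨s4, ?_⟩)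
      rw [Option.eq_none_iff_forall_ne_some]
      intro i hi
      have := faceLabel_eq_some.1 (linkedLabel_eq_some.1 hi).1
      rw [s6, q2] at this
      exact (Fin.castSucc_lt_last _).ne this.symm
    · intro z hz w hw e
      obtain ⟨z1, -, z3⟩ := hbad z hz
      obtain ⟨w1, -, w3⟩ := hbad w hw
      funext m
      by_cases hm : m = 3
      · rw [hm, z3, w3]
      · obtain ⟨l, rfl⟩ := ne_three_iff.1 hm
        have := congrFun e l
        simp only [cellNode_val z1, cellNode_val w1, Pi.add_apply] at this
        omega
  omega

theorem le_cost_instance4 (hO : IsNonOpposite P) (hn : 0 < n) :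
    3 * ((n : ℝ) * (n + 1) / 2 - (unlabeled n (linkedLabel P)).card) / n ^ 2 ≤
      cost instance4 P := by
  refine le_trans ?_ (card_mixedCells_le_cost P)
  refine div_le_div_of_nonneg_right ?_ (by positivity)
  have h1 := card_points_le hO hn
  have h2 := two_mul_card_points (n - 1)
  rw [show n - 1 + 1 = n by omega, show n - 1 + 2 = n + 1 by omega] at h2
  have h3 : (n : ℝ) * (n + 1) = 2 * ((points (n - 1)).card : ℝ) := by exact_mod_cast h2.symm
  have h4 : ((points (n - 1)).card : ℝ) ≤ (mixedCells P).card +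
    (unlabeled n (linkedLabel P)).card := by exact_mod_cast h1
  linarith

end MultiwayCut

end

noncomputable section

open scoped Classical

namespace MultiwayCut

variable {n : ℕ} {P : Node n → Fin 5}

/-! ### The combined instance -/

lemma cost_combined (c l₁ l₂ l₃ l₄ : ℝ) (P : Node n → Fin 5) :
    cost (combined c l₁ l₂ l₃ l₄) P = l₁ * cost instance1 P + l₂ * cost instance2 P +
      l₃ * cost (instance3 c) P + l₄ * cost instance4 P := by
  simp only [cost, combined, Finset.sum_add_distrib, Finset.mul_sum]

lemma one_le_lineChanges_zero {lab : (Fin 3 → ℕ) → Option (Fin 3)} (L : IsLinkedLabeling n lab)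
    (i : Fin 3) : 1 ≤ lineChanges n lab i 0 := by
  have h := Tri.succ i
  have hs := sum_pt h (n := n) (t := 0) (u := 0) (by omega)
  have := differ_add_differ_le_lineChanges (lab := lab) h hs pt_fst
  rw [differ_self, zero_add, pt_zero_zero h.rot.rot, pt_zero_zero h.rot.swap, L.corner, L.corner,
    differ_of_ne (by simp)] at this
  exact this

lemma cost_instance4_ge (hO : IsNonOpposite P) (hn : 0 < n) :
    3 / 2 - 3 * ((unlabeled n (linkedLabel P)).card / (n : ℝ) ^ 2) ≤ cost instance4 P := by
  refine le_trans ?_ (le_cost_instance4 hO hn)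
  have h0 : (0 : ℝ) < n := by exact_mod_cast hn
  have : 3 * ((n : ℝ) * (n + 1) / 2 - (unlabeled n (linkedLabel P)).card) / n ^ 2 =
      3 / 2 + 3 / 2 * (1 / n) - 3 * ((unlabeled n (linkedLabel P)).card / (n : ℝ) ^ 2) := by
    field_simp
  rw [this]
  have : 0 ≤ 3 / 2 * (1 / (n : ℝ)) := by positivity
  linarith

lemma cost_instance1_ge (hn : 3 ∣ n) (hn0 : 0 < n) :
    3 / 5 * (totalChanges n (linkedLabel P) / (n : ℝ)) ≤ cost instance1 P := by
  refine le_trans (le_of_eq ?_) (rho_mul_totalChanges_le_cost hn hn0)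
  have h0 : (n : ℝ) ≠ 0 := by exact_mod_cast hn0.ne'
  rw [rho]
  field_simp

/-- Needed in the single-change case because `3 λ₄ = 0.300663` slightly exceeds `2 λ₁ / 5 =
0.3006604`: the difference must be multiplied by a bounded density. -/
lemma density_unlabeled_le (hn : 0 < n) (lab : (Fin 3 → ℕ) → Option (Fin 3)) :
    ((unlabeled n lab).card : ℝ) / (n : ℝ) ^ 2 ≤ 1 / 2 + 5 / 2 * (1 / n) := by
  have h0 : (1 : ℝ) ≤ n := by exact_mod_cast hn
  have h1 : 2 * ((unlabeled n lab).card : ℝ) ≤ (n + 1) * (n + 2) := by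
    exact_mod_cast two_mul_card_unlabeled_le n lab
  rw [div_le_iff₀ (by positivity)]
  have : (1 / 2 + 5 / 2 * (1 / (n : ℝ))) * n ^ 2 = 1 / 2 * n ^ 2 + 5 / 2 * n := by
    field_simp
  rw [this]
  nlinarith

/-- Cuts with a single label change on some side. -/
lemma cost_ge_of_one_change (hn : 3 ∣ n) (hn0 : 0 < n) (hP : IsCut P) (hO : IsNonOpposite P)
    {c : ℝ} (hc : 0 < c) {i : Fin 3} (hi : lineChanges n (linkedLabel P) i 0 ≤ 1) :
    1.20016 - 20 * (1 / (n : ℝ)) ≤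
      cost (combined c 0.751651 0.147852 0.000276 0.100221) P := by
  have L := isLinkedLabeling_linkedLabel hP hO
  have h0 : (0 : ℝ) < n := by exact_mod_cast hn0
  have hE := hasExcess_of_one_change hn hn0 L (Tri.succ i).rot hi
  have a1 := cost_instance1_ge (P := P) hn hn0
  have a2 : 1 ≤ cost instance2 P := by
    refine le_trans ?_ (sum_lineChanges_le_cost (P := P) hn0)
    have h3 : 3 ≤ ∑ i, lineChanges n (linkedLabel P) i 0 := by
      rw [Fin.sum_univ_three]
      have := one_le_lineChanges_zero L 0
      have := one_le_lineChanges_zero L 1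
      have := one_le_lineChanges_zero L 2
      omega
    have h3' : (3 : ℝ) ≤ (∑ i, lineChanges n (linkedLabel P) i 0 : ℕ) := by exact_mod_cast h3
    linarith
  have a3 : 0 ≤ cost (instance3 c) P := Finset.sum_nonneg fun e _ => instance3_nonneg hc e
  have a4 := cost_instance4_ge hO hn0
  have a5 := density_unlabeled_le hn0 (linkedLabel P)
  rw [cost_combined]
  unfold HasExcess at hE
  set U : ℝ := ((unlabeled n (linkedLabel P)).card : ℝ)
  set T : ℝ := (totalChanges n (linkedLabel P) : ℝ)
  have hE' : 2 / 3 * (U / (n : ℝ) ^ 2) ≤ T / n - 2 + 20 * (1 / n) := by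
    have e : T / n - 2 + 20 * (1 / n) = 3 * n * (T - 2 * n + 20) / (3 * n ^ 2) := by
      field_simp
    have e2 : 2 / 3 * (U / (n : ℝ) ^ 2) = 2 * U / (3 * n ^ 2) := by
      field_simp
    rw [e, e2]
    exact div_le_div_of_nonneg_right hE (by positivity)
  have hn1 : 0 ≤ 1 / (n : ℝ) := by positivity
  generalize U / (n : ℝ) ^ 2 = a at *
  generalize T / (n : ℝ) = t at *
  generalize 1 / (n : ℝ) = r at *
  linarith

/-- Cuts with two label changes on every side. -/
lemma cost_ge_of_two_changes (hn : 3 ∣ n) (hn0 : 0 < n) (hP : IsCut P) (hO : IsNonOpposite P)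
    {m : ℕ} (hm : (0.074125 : ℝ) * n = m)
    (h2 : ∀ i, 2 ≤ lineChanges n (linkedLabel P) i 0) :
    1.20016 - 20 * (1 / (n : ℝ)) ≤
      cost (combined 0.074125 0.751651 0.147852 0.000276 0.100221) P := by
  have L := isLinkedLabeling_linkedLabel hP hO
  have h0 : (0 : ℝ) < n := by exact_mod_cast hn0
  have hmn : 2 * m < n := by
    have : (2 * m : ℝ) < n := by rw [← hm]; linarith
    exact_mod_cast this
  have a1 := cost_instance1_ge (P := P) hn hn0
  have a2 : 2 ≤ cost instance2 P := by
    refine le_trans ?_ (sum_lineChanges_le_cost (P := P) hn0)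
    have h3 : 6 ≤ ∑ i, lineChanges n (linkedLabel P) i 0 := by
      rw [Fin.sum_univ_three]
      have := h2 0
      have := h2 1
      have := h2 2
      omega
    have h3' : (6 : ℝ) ≤ (∑ i, lineChanges n (linkedLabel P) i 0 : ℕ) := by exact_mod_cast h3
    linarith
  have a3 := card_not_isSealed_le_cost (P := P) hn0 hP (c := 0.074125) (by norm_num) hm hmn
  have a4 := cost_instance4_ge hO hn0
  set K := Finset.univ.filter fun k => IsSealed n (linkedLabel P) m k with hK
  have hK3 : K.card + (Finset.univ.filter fun k => ¬ IsSealed n (linkedLabel P) m k).card = 3 :=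
    (Finset.card_filter_add_card_filter_not _).trans (by simp)
  have a5 := card_unlabeled_add_le hn L hmn (K := K) fun k hk => (Finset.mem_filter.1 hk).2
  have a6 := le_totalChanges hn L (Tri.succ 0)
  have hsl := (Tri.succ 0).sum (slackSum n (linkedLabel P))
  rw [← hsl] at a6
  rw [cost_combined]
  generalize (Finset.univ.filter fun k => ¬ IsSealed n (linkedLabel P) m k).card = q at *
  generalize K.card = p at *
  generalize ∑ i, slackSum n (linkedLabel P) i = s at *
  set U : ℝ := ((unlabeled n (linkedLabel P)).card : ℝ) with hU
  set T : ℝ := (totalChanges n (linkedLabel P) : ℝ) with hT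
  have b5 : 2 * U + p * (((m : ℝ) + 1) * (m + 2)) ≤ (n + 1) * (n + 2) + 2 * (s * (m + 1)) := by
    rw [hU]; exact_mod_cast a5
  have b6 : 2 * (n : ℝ) + s ≤ T + 3 := by rw [hT]; exact_mod_cast a6
  have b3 : (p : ℝ) + q = 3 := by exact_mod_cast hK3
  have hp : (0 : ℝ) ≤ p := Nat.cast_nonneg _
  have hs : (0 : ℝ) ≤ s := Nat.cast_nonneg _
  have hn3 : (3 : ℝ) ≤ n := by exact_mod_cast Nat.le_of_dvd hn0 hn
  have c1 : 2 - 3 * (1 / (n : ℝ)) + s / n ≤ T / n := by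
    have : 2 - 3 * (1 / (n : ℝ)) + s / n = (2 * n - 3 + s) / n := by field_simp
    rw [this]
    exact div_le_div_of_nonneg_right (by linarith) h0.le
  have c2 : U / (n : ℝ) ^ 2 ≤
      1 / 2 + 5 / 2 * (1 / n) + 1 / 2 * (s / n) - p * (0.074125 ^ 2 / 2) := by
    rw [div_le_iff₀ (by positivity)]
    have e : (1 / 2 + 5 / 2 * (1 / (n : ℝ)) + 1 / 2 * (s / n) - p * (0.074125 ^ 2 / 2)) * n ^ 2 =
        1 / 2 * n ^ 2 + 5 / 2 * n + 1 / 2 * (s * n) - p * ((0.074125 * n) ^ 2 / 2) := by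
      field_simp
    rw [e, hm]
    have g1 : (p : ℝ) * (m : ℝ) ^ 2 ≤ p * (((m : ℝ) + 1) * (m + 2)) := by
      refine mul_le_mul_of_nonneg_left ?_ hp
      have : (0 : ℝ) ≤ m := Nat.cast_nonneg _
      nlinarith
    have g2 : 2 * ((s : ℝ) * (m + 1)) ≤ s * n := by
      have : 2 * ((m : ℝ) + 1) ≤ n := by rw [← hm]; linarith
      nlinarith
    nlinarith
  have hn1 : 0 ≤ 1 / (n : ℝ) := by positivity
  have hsn : 0 ≤ (s : ℝ) / n := by positivity
  have hq : (q : ℝ) = 3 - p := by linarith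
  rw [hq] at a3
  generalize U / (n : ℝ) ^ 2 = a at *
  generalize T / (n : ℝ) = t at *
  generalize (s : ℝ) / n = v at *
  generalize 1 / (n : ℝ) = r at *
  -- The slack `v` has the positive coefficient `3 λ₁ / 5 - 3 λ₄ / 2`. A sealed corner gains `3 λ₄
  -- c² / 2` in the fourth instance and an unsealed one `2 λ₃ / (9c)` in the third. These nearly
  -- agree, at about `0.000826` and `0.000827`, so the bound holds for every number `p` of sealed
  -- corners, with the least margin when all three are sealed.
  norm_num at a3 c2 ⊢
  linarith

end MultiwayCut

end

theorem corollary5 :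
    ∃ c l₁ l₂ l₃ l₄ : ℝ,
      c ∈ Set.Ioo (0 : ℝ) (1 / 2) ∧
      0 ≤ l₁ ∧ 0 ≤ l₂ ∧ 0 ≤ l₃ ∧ 0 ≤ l₄ ∧ l₁ + l₂ + l₃ + l₄ = 1 ∧
      c = 0.074125 ∧
      |l₁ - 0.751652| ≤ 0.000001 ∧ |l₂ - 0.147852| ≤ 0.000001 ∧
      |l₃ - 0.000275| ≤ 0.000001 ∧ |l₄ - 0.100221| ≤ 0.000001 ∧
      ∃ C : ℝ, ∀ n : ℕ, 0 < n → 3 ∣ n → (∃ m : ℕ, c * (n : ℝ) = m) →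
        ∀ P : MultiwayCut.Node n → Fin 5,
          MultiwayCut.IsCut P → MultiwayCut.IsNonOpposite P →
            1.20016 - C / (n : ℝ) ≤ MultiwayCut.cost (MultiwayCut.combined c l₁ l₂ l₃ l₄) P := by
  -- A mass of `10⁻⁶` is moved from `λ₁` to `λ₃`. With the unshifted values, the estimate for two
  -- changes on every side and no sealed corner would give only about `1.2001597`.
  refine ⟨0.074125, 0.751651, 0.147852, 0.000276, 0.100221, by norm_num, by norm_num, by norm_num,
    by norm_num, by norm_num, by norm_num, rfl, by norm_num [abs_le], by norm_num, by
    norm_num [abs_le], by norm_num, 20, fun n hn0 hn ⟨m, hm⟩ P hP hO => ?_⟩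
  rw [← mul_one_div]
  by_cases h : ∃ i, MultiwayCut.lineChanges n (MultiwayCut.linkedLabel P) i 0 ≤ 1
  · obtain ⟨i, hi⟩ := h
    exact MultiwayCut.cost_ge_of_one_change hn hn0 hP hO (by norm_num) hi
  · push Not at h
    exact MultiwayCut.cost_ge_of_two_changes hn hn0 hP hO hm fun i => h i
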